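/- **Theorem.** Consider Unique Coverage: given sets $S_1,\dots,S_m\subseteq[n]$ and $k\in\{1,\dots,m\}$, find a collection of at most $k$ of the sets that maximizes the number of elements lying in exactly one set of the collection. Let $r=\max_{j\in[n]}|\{i: j\in S_i\}|$ be the maximum multiplicity of an element. A randomized one-pass algorithm knows $n,m,k$ (but not $r$) in advance; it reads the sets one after the other in an arbitrary order, the elements of each set one at a time in an arbitrary order followed by an end marker, reads each symbol of the stream only once, may toss fair coins, and at the end outputs the indices of at most $k$ sets. Its space is the larger of the maximum number of symbols of memory kept between consecutive stream symbols (random bits that are to be used again must be stored) and the number of coins tossed per step. There is an absolute constant $A>0$ such that for every $c\in\mathbb N$ there are a randomized one-pass algorithm and constants $B,b$ (depending only on $c$) such that for all $n$, all $1\le k\le m$ and all inputs $S_1,\dots,S_m\subseteq[n]$, in whatever order presented: 1. the algorithm uses $\tilde O(k^2)$ space: for every outcome of the coin tosses, at most $B\,k^2\,(\log(m+n+1))^{b}$; 2. with probability at least $1-m^{-c}$ it outputs a collection of at most $k$ sets that is an $O(\log\min(k,r))$-approximation: if $\mathrm{OPT}$ is the maximum number of elements that at most $k$ of the sets can uniquely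 cover, then the output uniquely covers at least $\dfrac{\mathrm{OPT}}{A\,(1+\log\min(k,r))}$ elements (for $r=0$ all sets are empty, $\mathrm{OPT}=0$, and nothing is required of the number of uniquely covered elements). -/

import Mathlib

open scoped ENNReal

namespace UniqueCoverage

/-! ### Set systems `S_1, …, S_m ⊆ [n]` -/

/-- The elements that lie in exactly one of the sets `S i`, `i ∈ I`. -/
def uniquelyCovered {m n : ℕ} (S : Fin m → Finset (Fin n)) (I : Finset (Fin m)) :
    Finset (Fin n) :=
  Finset.univ.filter fun j => (I.filter fun i => j ∈ S i).card = 1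

/-- The optimal value of Unique Coverage with at most `k` sets. -/
def opt {m n : ℕ} (S : Fin m → Finset (Fin n)) (k : ℕ) : ℕ :=
  ((Finset.univ : Finset (Finset (Fin m))).filter fun I => I.card ≤ k).sup
    fun I => (uniquelyCovered S I).card

/-- The maximum multiplicity `r` of an element. -/
def maxMultiplicity {m n : ℕ} (S : Fin m → Finset (Fin n)) : ℕ :=
  Finset.univ.sup fun j : Fin n => (Finset.univ.filter fun i => j ∈ S i).card

/-- The list `o` of set indices (counted from `0`) names an `α`-approximate solution: a collection
of at most `k` of the input sets whose unique coverage is at least `opt / α`. -/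
def IsApproxSolution {m n : ℕ} (S : Fin m → Finset (Fin n)) (k : ℕ) (α : ℝ) (o : List ℕ) : Prop :=
  ∃ I : Finset (Fin m), I.image Fin.val = o.toFinset ∧ I.card ≤ k ∧
    (opt S k : ℝ) ≤ α * ((uniquelyCovered S I).card : ℝ)

/-! ### Streams

A stream is a sequence of tokens: the sets come one after the other; of each set the elements are
listed one at a time (`some x`), in arbitrary order, and then an end marker (`none`) follows. -/

/-- `L i` lists the elements of `S i`, each exactly once. -/
def Lists {m n : ℕ} (L : Fin m → List (Fin n)) (S : Fin m → Finset (Fin n)) : Prop :=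
  ∀ i, (L i).Nodup ∧ (L i).toFinset = S i

/-- The token stream in which the sets are listed by `L 0, L 1, …`. -/
def tokens {m n : ℕ} (L : Fin m → List (Fin n)) : List (Option ℕ) :=
  (List.ofFn L).flatMap fun l => l.map (fun x => some (x : ℕ)) ++ [none]

/-! ### Randomized one-pass algorithms -/

/-- A randomized one-pass streaming algorithm. It is one computable procedure for all inputs, and
is given the parameters `(n, m, k)` in advance. Its memory is a list of natural numbers. It tosses
`coins (n, m, k)` fresh fair coins at the start and again at each token (handed over as the number
of which they are the binary digits); these are forgotten unless they are written to the memory.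
Each token is read once, and the answer is computed from the final memory alone. -/
structure StreamAlg where
  coins : ℕ × ℕ × ℕ → ℕ
  init : ℕ × ℕ × ℕ → ℕ → List ℕ
  step : ℕ × ℕ × ℕ → List ℕ → Option ℕ → ℕ → List ℕ
  out : ℕ × ℕ × ℕ → List ℕ → List ℕ
  computable_coins : Computable coins
  computable_init : Computable fun x : (ℕ × ℕ × ℕ) × ℕ => init x.1 x.2
  computable_step : Computable fun x : (ℕ × ℕ × ℕ) × List ℕ × Option ℕ × ℕ =>
    step x.1 x.2.1 x.2.2.1 x.2.2.2
  computable_out : Computable fun x : (ℕ × ℕ × ℕ) × List ℕ => out x.1 x.2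

/-- The outcome of `c` fair coin tosses, as a uniformly random number below `2 ^ c`. -/
noncomputable def coinLaw (c : ℕ) : PMF ℕ :=
  (PMF.uniformOfFintype (Fin (2 ^ c))).map Fin.val

/-- The number of symbols of a memory content: binary digits, and one delimiter for each number. -/
def memSize (M : List ℕ) : ℕ := (M.map fun w => Nat.size w + 1).sum

namespace StreamAlg

/-- The law of the memory after the tokens `w` have been read. -/
noncomputable def law (alg : StreamAlg) (p : ℕ × ℕ × ℕ) (w : List (Option ℕ)) : PMF (List ℕ) :=
  w.foldl
    (fun μ t => μ.bind fun M => (coinLaw (alg.coins p)).map fun ω => alg.step p M t ω)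
    ((coinLaw (alg.coins p)).map fun ω => alg.init p ω)

/-- The law of the answer on the stream `w`. -/
noncomputable def outLaw (alg : StreamAlg) (p : ℕ × ℕ × ℕ) (w : List (Option ℕ)) : PMF (List ℕ) :=
  (alg.law p w).map (alg.out p)

/-- On the stream `w`, at every moment and for every outcome of the coin tosses, the memory and the
coins of the current step take up at most `s` symbols each. -/
def UsesSpace (alg : StreamAlg) (p : ℕ × ℕ × ℕ) (w : List (Option ℕ)) (s : ℝ) : Prop :=
  (alg.coins p : ℝ) ≤ s ∧
    ∀ v : List (Option ℕ), v <+: w → ∀ M ∈ (alg.law p v).support, (memSize M : ℝ) ≤ s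

end StreamAlg

end UniqueCoverage

-- The algorithm runs many instances in parallel, one for each pair of a hash function and a guess
-- `2 ^ (i + 1)` of OPT. An instance sees only the elements that its hash function samples, with
-- probability about `rate / scale`; if the guess is at most `rate`, it sees everything. It is
-- greedy: while fewer than `k` sets are kept, it keeps a set exactly if that set adds at least
-- `goal / (16 k)` new sampled elements. At the end an exhaustive search over subfamilies of kept
-- sets in all instances selects the one with the largest estimated unique coverage.
--
-- Greedy selection (`le_coverage_of_greedy`): if `k` sets are kept, their gains add up; if not,
-- every set of an optimal solution that was not kept adds little, so most of the sampled optimum is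
-- covered. Either way the coverage is at least `goal / 16`.
--
-- From coverage to unique coverage (`exists_subfamily_uniquely_covering`): one dyadic class of
-- element degrees contains a `1 / (1 + log d)` fraction of the covered elements. Choosing each set
-- with probability about the inverse of that degree covers a constant fraction of the class
-- uniquely. Applied to the kept sets, where `d = min k r`, this gives the logarithmic factor.
--
-- Sampling errors are treated asymmetrically. Overestimates must be excluded for all at most `(m +
-- 1) ^ k` unique coverages, in every instance. This uses hash polynomials with `indep`, about `k
-- log`, coefficients, whose high binomial moments give a tail `2 ^ (-indep)`
-- (`card_overSampling_le`). Underestimates matter only for one optimal coverage and one hash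
-- function: Chebyshev's inequality gives probability at least 1/2 (`card_underSampling_le`), and
-- independent repetitions amplify it. `card_not_isGoodSeed_le` combines the two, and
-- `IsRunState.le_card_answer` derives the approximation from a good seed.
--
-- Space is bounded for every seed because an instance is given up at `capacity` records. The
-- instance with the right guess is not given up: a single set uniquely covers all its elements, so
-- it has at most OPT elements and, for a good seed, fewer than `4 * rate` sampled ones, and at most
-- `k` kept sets and the current one are recorded. Since `rate` is about `k` up to logarithms,
-- `capacity` is about `k ^ 2`.

attribute [fun_prop] Primrec
attribute [fun_prop] Primrec.id Primrec.const Primrec.comp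

namespace UniqueCoverage

/-! ### Closure properties of primitive recursive functions -/

section Primrec

variable {α β γ : Type*} [Primcodable α] [Primcodable β] [Primcodable γ]

@[fun_prop]
theorem primrec_fst {f : α → β × γ} (hf : Primrec f) : Primrec fun a => (f a).1 :=
  Primrec.fst.comp hf

@[fun_prop]
theorem primrec_snd {f : α → β × γ} (hf : Primrec f) : Primrec fun a => (f a).2 :=
  Primrec.snd.comp hf

@[fun_prop]
theorem primrec_mk {f : α → β} {g : α → γ} (hf : Primrec f) (hg : Primrec g) :
    Primrec fun a => (f a, g a) :=
  hf.pair hg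

@[fun_prop]
theorem primrec_add {f g : α → ℕ} (hf : Primrec f) (hg : Primrec g) :
    Primrec fun a => f a + g a :=
  Primrec.nat_add.comp hf hg

@[fun_prop]
theorem primrec_mul {f g : α → ℕ} (hf : Primrec f) (hg : Primrec g) :
    Primrec fun a => f a * g a :=
  Primrec.nat_mul.comp hf hg

@[fun_prop]
theorem primrec_div {f g : α → ℕ} (hf : Primrec f) (hg : Primrec g) :
    Primrec fun a => f a / g a :=
  Primrec.nat_div.comp hf hg

@[fun_prop]
theorem primrec_mod {f g : α → ℕ} (hf : Primrec f) (hg : Primrec g) :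
    Primrec fun a => f a % g a :=
  Primrec.nat_mod.comp hf hg

@[fun_prop]
theorem primrec_max {f g : α → ℕ} (hf : Primrec f) (hg : Primrec g) :
    Primrec fun a => max (f a) (g a) :=
  Primrec.nat_max.comp hf hg

@[fun_prop]
theorem primrec_min {f g : α → ℕ} (hf : Primrec f) (hg : Primrec g) :
    Primrec fun a => min (f a) (g a) :=
  Primrec.nat_min.comp hf hg

@[fun_prop]
theorem primrec_pow {f g : α → ℕ} (hf : Primrec f) (hg : Primrec g) :
    Primrec fun a => f a ^ g a :=
  (Primrec₂.unpaired'.1 Nat.Primrec.pow).comp hf hg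

@[fun_prop]
theorem primrec_natPair {f g : α → ℕ} (hf : Primrec f) (hg : Primrec g) :
    Primrec fun a => Nat.pair (f a) (g a) :=
  Primrec₂.natPair.comp hf hg

@[fun_prop]
theorem primrec_unpair {f : α → ℕ} (hf : Primrec f) : Primrec fun a => (f a).unpair :=
  Primrec.unpair.comp hf

@[fun_prop]
theorem primrec_decide_le {f g : α → ℕ} (hf : Primrec f) (hg : Primrec g) :
    Primrec fun a => decide (f a ≤ g a) :=
  (Primrec.nat_le.comp hf hg).decide

@[fun_prop]
theorem primrec_decide_lt {f g : α → ℕ} (hf : Primrec f) (hg : Primrec g) :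
    Primrec fun a => decide (f a < g a) :=
  (Primrec.nat_lt.comp hf hg).decide

@[fun_prop]
theorem primrec_decide_eq {f g : α → ℕ} (hf : Primrec f) (hg : Primrec g) :
    Primrec fun a => decide (f a = g a) :=
  (Primrec.eq.comp hf hg).decide

@[fun_prop]
theorem primrec_and {f g : α → Bool} (hf : Primrec f) (hg : Primrec g) :
    Primrec fun a => f a && g a :=
  Primrec.and.comp hf hg

@[fun_prop]
theorem primrec_or {f g : α → Bool} (hf : Primrec f) (hg : Primrec g) :
    Primrec fun a => f a || g a :=
  Primrec.or.comp hf hg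

@[fun_prop]
theorem primrec_not {f : α → Bool} (hf : Primrec f) : Primrec fun a => !f a :=
  Primrec.not.comp hf

@[fun_prop]
theorem primrec_toNat {f : α → Bool} (hf : Primrec f) : Primrec fun a => (f a).toNat :=
  (Primrec.dom_bool Bool.toNat).comp hf

@[fun_prop]
theorem primrec_testBit {f g : α → ℕ} (hf : Primrec f) (hg : Primrec g) :
    Primrec fun a => (f a).testBit (g a) := by
  simp only [Nat.testBit_eq_decide_div_mod_eq]
  fun_prop

@[fun_prop]
theorem primrec_contains {f : α → List ℕ} {g : α → ℕ} (hf : Primrec f) (hg : Primrec g) :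
    Primrec fun a => decide (g a ∈ f a) := by
  have h : Primrec fun a => decide ((f a).idxOf (g a) < (f a).length) :=
    primrec_decide_lt (Primrec.list_idxOf.comp hg hf) (Primrec.list_length.comp hf)
  simpa only [List.idxOf_lt_length_iff] using h

@[fun_prop]
theorem primrec_cons {f : α → ℕ} {g : α → List ℕ} (hf : Primrec f) (hg : Primrec g) :
    Primrec fun a => f a :: g a :=
  Primrec.list_cons.comp hf hg

@[fun_prop]
theorem primrec_append {f g : α → List ℕ} (hf : Primrec f) (hg : Primrec g) :
    Primrec fun a => f a ++ g a :=
  Primrec.list_append.comp hf hg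

@[fun_prop]
theorem primrec_headI {f : α → List ℕ} (hf : Primrec f) : Primrec fun a => (f a).headI :=
  Primrec.list_headI.comp hf

@[fun_prop]
theorem primrec_tail {f : α → List ℕ} (hf : Primrec f) : Primrec fun a => (f a).tail :=
  Primrec.list_tail.comp hf

@[fun_prop]
theorem primrec_length {f : α → List ℕ} (hf : Primrec f) : Primrec fun a => (f a).length :=
  Primrec.list_length.comp hf

@[fun_prop]
theorem primrec_range {f : α → ℕ} (hf : Primrec f) : Primrec fun a => List.range (f a) :=
  Primrec.list_range.comp hf

theorem primrec_map {f : α → List ℕ} {g : α → ℕ → ℕ} (hf : Primrec f)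
    (hg : Primrec fun q : α × ℕ => g q.1 q.2) : Primrec fun a => (f a).map (g a) :=
  Primrec.list_map hf hg

theorem primrec_filter {f : α → List ℕ} {g : α → ℕ → Bool} (hf : Primrec f)
    (hg : Primrec fun q : α × ℕ => g q.1 q.2) : Primrec fun a => (f a).filter (g a) := by
  have h : Primrec fun a => (f a).filterMap fun x => bif g a x then some x else none :=
    Primrec.listFilterMap hf (Primrec.cond hg (Primrec.option_some.comp Primrec.snd)
      (Primrec.const none))
  refine h.of_eq fun a => ?_
  rw [← List.filterMap_eq_filter]
  congr 1
  funext x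
  cases hx : g a x <;> simp [Option.guard, hx]

/-- Counts and bounded quantifiers of the algorithm are written as sums of `Bool.toNat` over ranges,
and its searches as `Nat.findGreatest`. This lemma and `primrec_findGreatest` therefore carry its
computability; the rest is composition, left to `fun_prop`. -/
theorem primrec_sum {f : α → ℕ} {g : α → ℕ → ℕ} (hf : Primrec f)
    (hg : Primrec fun q : α × ℕ => g q.1 q.2) :
    Primrec fun a => ∑ i ∈ Finset.range (f a), g a i := by
  have h : Primrec fun a => Nat.rec (motive := fun _ => ℕ) 0 (fun i s => s + g a i) (f a) := by
    refine Primrec.nat_rec' hf (Primrec.const 0) (h := fun a q => q.2 + g a q.1) ?_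
    have hg' : Primrec fun q : α × ℕ × ℕ => g q.1 q.2.1 :=
      hg.comp (f := fun q : α × ℕ => g q.1 q.2) (g := fun q : α × ℕ × ℕ => (q.1, q.2.1))
        (by fun_prop)
    exact primrec_add (by fun_prop) hg'
  refine h.of_eq fun a => ?_
  induction f a with
  | zero => simp
  | succ n ih => simp [Finset.sum_range_succ, ih]

theorem primrec_findGreatest {f : α → ℕ} {P : α → ℕ → Bool} (hf : Primrec f)
    (hP : Primrec fun q : α × ℕ => P q.1 q.2) :
    Primrec fun a => Nat.findGreatest (fun x => P a x = true) (f a) :=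
  Primrec.nat_findGreatest hf (p := fun a x => P a x = true)
    (Primrec.primrecPred (p := fun q : α × ℕ => P q.1 q.2 = true) (by simpa using hP))

theorem primrec_decide_prime : Primrec fun p : ℕ => decide p.Prime := by
  have h : Primrec fun p : ℕ => decide (2 ≤ p) &&
      decide (∑ m ∈ Finset.range p, (decide (2 ≤ m) && decide (p % m = 0)).toNat = 0) := by
    have hs := primrec_sum (α := ℕ) (f := fun p => p)
      (g := fun p m => (decide (2 ≤ m) && decide (p % m = 0)).toNat) Primrec.id (by fun_prop)
    fun_prop
  refine h.of_eq fun p => ?_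
  rw [← Bool.decide_and]
  congr 1
  rw [Nat.prime_def_lt', Finset.sum_eq_zero_iff]
  refine propext (and_congr_right fun _ => forall_congr' fun m => ?_)
  simp [Nat.dvd_iff_mod_eq_zero]
  tauto

@[fun_prop]
theorem primrec_decide_prime_comp {f : α → ℕ} (hf : Primrec f) :
    Primrec fun a => decide (f a).Prime :=
  primrec_decide_prime.comp hf

end Primrec

/-! ### The algorithm

The memory consists of the random seed, the index of the current set, and a list of records. A
record names an instance `j`, a set `i` and an element `x` of that set which instance `j` samples.
Instance `j` uses the hash function number `j / lgSize p` and the guess `2 ^ (j % lgSize p + 1)` of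
the optimum. -/

/-- The number of binary digits of `m + n + 1`. -/
def lgSize (p : ℕ × ℕ × ℕ) : ℕ :=
  Nat.findGreatest (fun l => decide (2 ^ l ≤ p.1 + p.2.1 + 1) = true) (p.1 + p.2.1 + 1) + 1

/-- The size of the prime field over which the hash functions are polynomials. -/
def fieldSize (p : ℕ × ℕ × ℕ) : ℕ :=
  Nat.findGreatest (fun q => decide q.Prime = true) (2 * 2 ^ lgSize p)

/-- The degree of independence of the hash functions. -/
def indep (c : ℕ) (p : ℕ × ℕ × ℕ) : ℕ := (2 * c + 10) * p.2.2 * lgSize p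

/-- The number of independent hash functions. -/
def reps (c : ℕ) (p : ℕ × ℕ × ℕ) : ℕ := (c + 3) * lgSize p

/-- The number of elements that an instance is meant to sample. -/
def rate (c : ℕ) (p : ℕ × ℕ × ℕ) : ℕ := 512 * lgSize p * indep c p

/-- The number of records at which an instance is given up. -/
def capacity (c : ℕ) (p : ℕ × ℕ × ℕ) : ℕ := 4 * rate c p * (p.2.2 + 1)

/-- The number by which the sampling rate `rate c p / scale c p i` of level `i` is divided. -/
def scale (c : ℕ) (p : ℕ × ℕ × ℕ) (i : ℕ) : ℕ := max (2 ^ (i + 1)) (rate c p)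

/-- The elements with hash values below this threshold are sampled. -/
def threshold (c : ℕ) (p : ℕ × ℕ × ℕ) (i : ℕ) : ℕ := fieldSize p * rate c p / scale c p i

/-- The coverage of the sample aimed at on level `i`, up to a constant factor. -/
def goal (c : ℕ) (p : ℕ × ℕ × ℕ) (i : ℕ) : ℕ := min (2 ^ (i + 1)) (rate c p)

/-- The value at `x` of the hash function number `ρ` given by the seed `ω`. -/
def hashValue (c : ℕ) (p : ℕ × ℕ × ℕ) (ω ρ x : ℕ) : ℕ :=
  (∑ d ∈ Finset.range (indep c p),
    ω / fieldSize p ^ (d + indep c p * ρ) % fieldSize p * x ^ d) % fieldSize p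

/-- Whether instance `j` samples the element `x`. -/
def sampled (c : ℕ) (p : ℕ × ℕ × ℕ) (ω j x : ℕ) : Bool :=
  decide (hashValue c p ω (j / lgSize p) x < threshold c p (j % lgSize p))

/-- The record of the element `x` of set `i` in instance `j`. -/
def record (j i x : ℕ) : ℕ := Nat.pair j (Nat.pair i x)

/-- The number of records of instance `j`. -/
def load (recs : List ℕ) (j : ℕ) : ℕ := (recs.filter fun e => decide (e.unpair.1 = j)).length

/-- Whether instance `j` has a record of set `i`. -/
def isKept (n : ℕ) (recs : List ℕ) (j i : ℕ) : Bool :=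
  decide (0 < ∑ x ∈ Finset.range n, (decide (record j i x ∈ recs)).toNat)

/-- The number of sets before set `cur` that instance `j` has kept. -/
def numKept (n : ℕ) (recs : List ℕ) (j cur : ℕ) : ℕ :=
  ∑ i ∈ Finset.range cur, (isKept n recs j i).toNat

/-- The number of sets before set `cur` with a record of `x` in instance `j`. -/
def multiplicity (recs : List ℕ) (j cur x : ℕ) : ℕ :=
  ∑ i ∈ Finset.range cur, (decide (record j i x ∈ recs)).toNat

/-- The number of elements of the sample that set `cur` adds in instance `j`. -/
def gain (n : ℕ) (recs : List ℕ) (j cur : ℕ) : ℕ :=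
  ∑ x ∈ Finset.range n,
    (decide (record j cur x ∈ recs) && decide (multiplicity recs j cur x = 0)).toNat

/-- Whether instance `j` keeps the set `cur`. -/
def accepts (c : ℕ) (p : ℕ × ℕ × ℕ) (cur : ℕ) (recs : List ℕ) (j : ℕ) : Bool :=
  decide (numKept p.1 recs j cur < p.2.2) &&
    decide (goal c p (j % lgSize p) ≤ gain p.1 recs j cur * (16 * p.2.2))

/-- Whether the record `e` is kept at the end of set `cur`. -/
def survives (c : ℕ) (p : ℕ × ℕ × ℕ) (cur : ℕ) (recs : List ℕ) (e : ℕ) : Bool :=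
  !decide (e.unpair.2.unpair.1 = cur) || decide (capacity c p ≤ load recs e.unpair.1) ||
    accepts c p cur recs e.unpair.1

/-- The records after the element `x` of set `cur` has been read. -/
def readElement (c : ℕ) (p : ℕ × ℕ × ℕ) (ω cur : ℕ) (recs : List ℕ) (x : ℕ) : List ℕ :=
  ((List.range (reps c p * lgSize p)).filter fun j =>
    sampled c p ω j x && decide (load recs j < capacity c p)).map (fun j => record j cur x) ++ recs

/-- The records after the end of set `cur`. -/
def closeSet (c : ℕ) (p : ℕ × ℕ × ℕ) (cur : ℕ) (recs : List ℕ) : List ℕ :=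
  recs.filter (survives c p cur recs)

/-- The records after a token has been read. -/
def readToken (c : ℕ) (p : ℕ × ℕ × ℕ) (M : List ℕ) (t : Option ℕ) : List ℕ :=
  t.casesOn
    (M.headI :: (M.tail.headI + 1) :: closeSet c p M.tail.headI M.tail.tail)
    (fun x => M.headI :: M.tail.headI :: readElement c p M.headI M.tail.headI M.tail.tail x)

/-- The number of elements of the sample that exactly one of the sets named by the binary digits of
`b` covers, according to the records of instance `j`. -/
def sampleCoverage (p : ℕ × ℕ × ℕ) (recs : List ℕ) (j b : ℕ) : ℕ :=
  ∑ x ∈ Finset.range p.1, (decide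
    (∑ i ∈ Finset.range p.2.1, (b.testBit i && decide (record j i x ∈ recs)).toNat = 1)).toNat

/-- Whether instance `j` vouches for the sets named by the binary digits of `b`. -/
def isCandidate (c : ℕ) (p : ℕ × ℕ × ℕ) (recs : List ℕ) (j b : ℕ) : Bool :=
  decide (load recs j < capacity c p) &&
  decide (∑ i ∈ Finset.range p.2.1, (b.testBit i && !isKept p.1 recs j i).toNat = 0) &&
  (decide (4 * indep c p ≤ sampleCoverage p recs j b) ||
    decide (2 ^ (j % lgSize p + 1) ≤ rate c p))

/-- The estimate of the unique coverage of the sets named by `b`, times `rate c p`. -/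
def score (c : ℕ) (p : ℕ × ℕ × ℕ) (recs : List ℕ) (j b : ℕ) : ℕ :=
  sampleCoverage p recs j b * scale c p (j % lgSize p)

/-- A bound for all scores. -/
def scoreBound (c : ℕ) (p : ℕ × ℕ × ℕ) : ℕ := p.1 * (2 ^ lgSize p + rate c p)

/-- The number of pairs `(j, b)`. -/
def numChoices (c : ℕ) (p : ℕ × ℕ × ℕ) : ℕ := reps c p * lgSize p * 2 ^ p.2.1

/-- A candidate of highest score, together with its score. -/
def bestChoice (c : ℕ) (p : ℕ × ℕ × ℕ) (recs : List ℕ) : ℕ :=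
  Nat.findGreatest
    (fun v => (isCandidate c p recs (v % numChoices c p / 2 ^ p.2.1) (v % numChoices c p % 2 ^ p.2.1)
      && decide (v / numChoices c p ≤
        score c p recs (v % numChoices c p / 2 ^ p.2.1) (v % numChoices c p % 2 ^ p.2.1))) = true)
    ((scoreBound c p + 1) * numChoices c p)

/-- The answer. -/
def answer (c : ℕ) (p : ℕ × ℕ × ℕ) (recs : List ℕ) : List ℕ :=
  (List.range p.2.1).filter fun i =>
    (bestChoice c p recs % numChoices c p % 2 ^ p.2.1).testBit i

/-! ### Computability of the algorithm -/

section Primrec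

variable {α : Type*} [Primcodable α]

theorem primrec_lgSize : Primrec lgSize :=
  Primrec.succ.comp (primrec_findGreatest (α := ℕ × ℕ × ℕ) (f := fun p => p.1 + p.2.1 + 1)
    (P := fun p l => decide (2 ^ l ≤ p.1 + p.2.1 + 1)) (by fun_prop) (by fun_prop))

@[fun_prop]
theorem primrec_lgSize_comp {f : α → ℕ × ℕ × ℕ} (hf : Primrec f) :
    Primrec fun a => lgSize (f a) := primrec_lgSize.comp hf

@[fun_prop]
theorem primrec_fieldSize {f : α → ℕ × ℕ × ℕ} (hf : Primrec f) :
    Primrec fun a => fieldSize (f a) :=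
  primrec_findGreatest (f := fun a => 2 * 2 ^ lgSize (f a)) (P := fun _ q => decide q.Prime)
    (by fun_prop) (by fun_prop)

@[fun_prop]
theorem primrec_indep (c : ℕ) {f : α → ℕ × ℕ × ℕ} (hf : Primrec f) :
    Primrec fun a => indep c (f a) := by unfold indep; fun_prop

@[fun_prop]
theorem primrec_reps (c : ℕ) {f : α → ℕ × ℕ × ℕ} (hf : Primrec f) :
    Primrec fun a => reps c (f a) := by unfold reps; fun_prop

@[fun_prop]
theorem primrec_rate (c : ℕ) {f : α → ℕ × ℕ × ℕ} (hf : Primrec f) :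
    Primrec fun a => rate c (f a) := by unfold rate; fun_prop

@[fun_prop]
theorem primrec_capacity (c : ℕ) {f : α → ℕ × ℕ × ℕ} (hf : Primrec f) :
    Primrec fun a => capacity c (f a) := by unfold capacity; fun_prop

@[fun_prop]
theorem primrec_scale (c : ℕ) {f : α → ℕ × ℕ × ℕ} {g : α → ℕ} (hf : Primrec f) (hg : Primrec g) :
    Primrec fun a => scale c (f a) (g a) := by unfold scale; fun_prop

@[fun_prop]
theorem primrec_threshold (c : ℕ) {f : α → ℕ × ℕ × ℕ} {g : α → ℕ} (hf : Primrec f)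
    (hg : Primrec g) : Primrec fun a => threshold c (f a) (g a) := by unfold threshold; fun_prop

@[fun_prop]
theorem primrec_goal (c : ℕ) {f : α → ℕ × ℕ × ℕ} {g : α → ℕ} (hf : Primrec f) (hg : Primrec g) :
    Primrec fun a => goal c (f a) (g a) := by unfold goal; fun_prop

@[fun_prop]
theorem primrec_hashValue (c : ℕ) {f : α → ℕ × ℕ × ℕ} {w r x : α → ℕ} (hf : Primrec f)
    (hw : Primrec w) (hr : Primrec r) (hx : Primrec x) :
    Primrec fun a => hashValue c (f a) (w a) (r a) (x a) := by
  unfold hashValue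
  exact primrec_mod (primrec_sum (by fun_prop) (by fun_prop)) (by fun_prop)

@[fun_prop]
theorem primrec_sampled (c : ℕ) {f : α → ℕ × ℕ × ℕ} {w j x : α → ℕ} (hf : Primrec f)
    (hw : Primrec w) (hj : Primrec j) (hx : Primrec x) :
    Primrec fun a => sampled c (f a) (w a) (j a) (x a) := by unfold sampled; fun_prop

@[fun_prop]
theorem primrec_record {j i x : α → ℕ} (hj : Primrec j) (hi : Primrec i) (hx : Primrec x) :
    Primrec fun a => record (j a) (i a) (x a) := by unfold record; fun_prop

variable {recs : α → List ℕ} {j cur x : α → ℕ} {f : α → ℕ × ℕ × ℕ}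

@[fun_prop]
theorem primrec_load (hr : Primrec recs) (hj : Primrec j) :
    Primrec fun a => load (recs a) (j a) := by
  unfold load
  exact primrec_length (primrec_filter hr (by fun_prop))

@[fun_prop]
theorem primrec_isKept {n : α → ℕ} (hn : Primrec n) (hr : Primrec recs) (hj : Primrec j)
    (hc : Primrec cur) : Primrec fun a => isKept (n a) (recs a) (j a) (cur a) := by
  unfold isKept
  exact primrec_decide_lt (by fun_prop) (primrec_sum hn (by fun_prop))

@[fun_prop]
theorem primrec_numKept {n : α → ℕ} (hn : Primrec n) (hr : Primrec recs) (hj : Primrec j)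
    (hc : Primrec cur) : Primrec fun a => numKept (n a) (recs a) (j a) (cur a) := by
  unfold numKept
  exact primrec_sum hc (by fun_prop)

@[fun_prop]
theorem primrec_multiplicity (hr : Primrec recs) (hj : Primrec j)
    (hc : Primrec cur) (hx : Primrec x) :
    Primrec fun a => multiplicity (recs a) (j a) (cur a) (x a) := by
  unfold multiplicity
  exact primrec_sum hc (by fun_prop)

@[fun_prop]
theorem primrec_gain {n : α → ℕ} (hn : Primrec n) (hr : Primrec recs) (hj : Primrec j)
    (hc : Primrec cur) : Primrec fun a => gain (n a) (recs a) (j a) (cur a) := by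
  unfold gain
  exact primrec_sum hn (by fun_prop)

@[fun_prop]
theorem primrec_accepts (c : ℕ) (hf : Primrec f) (hc : Primrec cur) (hr : Primrec recs)
    (hj : Primrec j) : Primrec fun a => accepts c (f a) (cur a) (recs a) (j a) := by
  unfold accepts; fun_prop

@[fun_prop]
theorem primrec_survives (c : ℕ) (hf : Primrec f) (hc : Primrec cur) (hr : Primrec recs)
    (hx : Primrec x) : Primrec fun a => survives c (f a) (cur a) (recs a) (x a) := by
  unfold survives; fun_prop

@[fun_prop]
theorem primrec_readElement (c : ℕ) {w : α → ℕ} (hf : Primrec f) (hw : Primrec w)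
    (hc : Primrec cur) (hr : Primrec recs) (hx : Primrec x) :
    Primrec fun a => readElement c (f a) (w a) (cur a) (recs a) (x a) := by
  unfold readElement
  exact primrec_append (primrec_map (primrec_filter (by fun_prop) (by fun_prop)) (by fun_prop)) hr

@[fun_prop]
theorem primrec_closeSet (c : ℕ) (hf : Primrec f) (hc : Primrec cur) (hr : Primrec recs) :
    Primrec fun a => closeSet c (f a) (cur a) (recs a) := by
  unfold closeSet
  exact primrec_filter hr (by fun_prop)

theorem primrec_readToken (c : ℕ) {t : α → Option ℕ} (hf : Primrec f) (hr : Primrec recs)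
    (ht : Primrec t) : Primrec fun a => readToken c (f a) (recs a) (t a) := by
  unfold readToken
  exact Primrec.option_casesOn (f := fun a => (recs a).headI :: ((recs a).tail.headI + 1) ::
      closeSet c (f a) (recs a).tail.headI (recs a).tail.tail)
    (g := fun a x => (recs a).headI :: (recs a).tail.headI ::
      readElement c (f a) (recs a).headI (recs a).tail.headI (recs a).tail.tail x)
    ht (by fun_prop) (by unfold Primrec₂; fun_prop)

@[fun_prop]
theorem primrec_sampleCoverage {b : α → ℕ} (hf : Primrec f) (hr : Primrec recs) (hj : Primrec j)
    (hb : Primrec b) : Primrec fun a => sampleCoverage (f a) (recs a) (j a) (b a) := by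
  unfold sampleCoverage
  exact primrec_sum (by fun_prop) (primrec_toNat (primrec_decide_eq
    (primrec_sum (by fun_prop) (by fun_prop)) (by fun_prop)))

@[fun_prop]
theorem primrec_isCandidate (c : ℕ) {b : α → ℕ} (hf : Primrec f) (hr : Primrec recs)
    (hj : Primrec j) (hb : Primrec b) :
    Primrec fun a => isCandidate c (f a) (recs a) (j a) (b a) := by
  unfold isCandidate
  have h : Primrec fun a => ∑ i ∈ Finset.range (f a).2.1,
      ((b a).testBit i && !isKept (f a).1 (recs a) (j a) i).toNat :=
    primrec_sum (by fun_prop) (by fun_prop)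
  fun_prop

@[fun_prop]
theorem primrec_score (c : ℕ) {b : α → ℕ} (hf : Primrec f) (hr : Primrec recs)
    (hj : Primrec j) (hb : Primrec b) :
    Primrec fun a => score c (f a) (recs a) (j a) (b a) := by
  unfold score; fun_prop

@[fun_prop]
theorem primrec_numChoices (c : ℕ) (hf : Primrec f) : Primrec fun a => numChoices c (f a) := by
  unfold numChoices; fun_prop

@[fun_prop]
theorem primrec_bestChoice (c : ℕ) (hf : Primrec f) (hr : Primrec recs) :
    Primrec fun a => bestChoice c (f a) (recs a) := by
  unfold bestChoice scoreBound
  exact primrec_findGreatest (by fun_prop) (by fun_prop)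

theorem primrec_answer (c : ℕ) (hf : Primrec f) (hr : Primrec recs) :
    Primrec fun a => answer c (f a) (recs a) := by
  unfold answer
  exact primrec_filter (by fun_prop) (by fun_prop)

end Primrec

/-- The streaming algorithm with failure probability `m ^ (-c)`. -/
def streamAlg (c : ℕ) : StreamAlg where
  coins p := (lgSize p + 1) * (reps c p * indep c p)
  init _ ω := [ω, 0]
  step p M t _ := readToken c p M t
  out p M := answer c p M.tail.tail
  computable_coins := by
    have : Primrec fun p : ℕ × ℕ × ℕ => (lgSize p + 1) * (reps c p * indep c p) := by fun_prop
    exact this.to_comp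
  computable_init := by
    have : Primrec fun x : (ℕ × ℕ × ℕ) × ℕ => [x.2, 0] := by fun_prop
    exact this.to_comp
  computable_step := by
    have : Primrec fun x : (ℕ × ℕ × ℕ) × List ℕ × Option ℕ × ℕ =>
        readToken c x.1 x.2.1 x.2.2.1 := primrec_readToken c (by fun_prop) (by fun_prop)
          (by fun_prop)
    exact this.to_comp
  computable_out := by
    have : Primrec fun x : (ℕ × ℕ × ℕ) × List ℕ => answer c x.1 x.2.tail.tail :=
      primrec_answer c (by fun_prop) (by fun_prop)
    exact this.to_comp


/-! ### Polynomial hash functions -/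

section Hash

variable {P : ℕ} [Fact P.Prime] {D : ℕ}

/-- The polynomial function with coefficients `a`. -/
def polyEval (a : Fin D → ZMod P) (x : ℕ) : ZMod P := ∑ d, a d * (x : ZMod P) ^ (d : ℕ)

/-- The elements of `U` with hash values below `T`. -/
def sampleOf (T : ℕ) (a : Fin D → ZMod P) (U : Finset ℕ) : Finset ℕ :=
  U.filter fun x => (polyEval a x).val < T

theorem natCast_injOn_of_lt {U : Finset ℕ} (hU : ∀ x ∈ U, x < P) :
    Set.InjOn (fun x : ℕ => (x : ZMod P)) U := by
  intro x hx y hy h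
  have h' := congrArg ZMod.val h
  simp only [ZMod.val_natCast] at h'
  rwa [Nat.mod_eq_of_lt (hU x hx), Nat.mod_eq_of_lt (hU y hy)] at h'

/-- Evaluation at the points of `V`, as a homomorphism. -/
def polyEvalHom (P D : ℕ) [Fact P.Prime] (V : Finset ℕ) : (Fin D → ZMod P) →+ (V → ZMod P) where
  toFun a x := polyEval a x
  map_zero' := by funext x; simp [polyEval]
  map_add' a b := by funext x; simp [polyEval, add_mul, Finset.sum_add_distrib]

/-- Lagrange interpolation: the points of `V` stay distinct modulo `P`, and the interpolating
polynomial has degree below `V.card ≤ D`. -/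
theorem polyEvalHom_surjective {V : Finset ℕ} (hV : ∀ x ∈ V, x < P) (hD : V.card ≤ D) :
    Function.Surjective (polyEvalHom P D V) := by
  classical
  intro r
  rcases V.eq_empty_or_nonempty with rfl | hne
  · exact ⟨0, funext fun x => absurd x.2 (Finset.notMem_empty _)⟩
  let r' : ℕ → ZMod P := fun x => if h : x ∈ V then r ⟨x, h⟩ else 0
  let q := Lagrange.interpolate V (fun x : ℕ => (x : ZMod P)) r'
  have hdeg : q.degree < (V.card : ℕ) := Lagrange.degree_interpolate_lt r' (natCast_injOn_of_lt hV)
  have hpos : 0 < V.card := Finset.card_pos.2 hne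
  have hnat : q.natDegree < D :=
    by
    rcases eq_or_ne q 0 with h0 | h0
    · rw [h0, Polynomial.natDegree_zero]; omega
    · exact ((Polynomial.natDegree_lt_iff_degree_lt h0).2 hdeg).trans_le hD
  refine ⟨fun d => q.coeff d, funext fun x => ?_⟩
  have h1 := Lagrange.eval_interpolate_at_node r' (natCast_injOn_of_lt hV) x.2
  rw [Polynomial.eval_eq_sum_range' hnat, ← Fin.sum_univ_eq_sum_range
    (fun d => q.coeff d * ((x : ℕ) : ZMod P) ^ d)] at h1
  simpa [polyEvalHom, polyEval, r'] using h1

/-- The fibres of a surjective homomorphism all have the same size. So for random coefficients the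
values at up to `D` points are independent and uniform. -/
theorem card_polyEvalHom_preimage {V : Finset ℕ} (hV : ∀ x ∈ V, x < P) (hD : V.card ≤ D)
    (B : Finset (V → ZMod P)) :
    (Finset.univ.filter fun a => polyEvalHom P D V a ∈ B).card * P ^ V.card
      = B.card * P ^ D := by
  classical
  have hs := polyEvalHom_surjective hV hD
  set κ := (Finset.univ.filter fun a => polyEvalHom P D V a = 0).card with hκ
  have hfib : ∀ B : Finset (V → ZMod P),
      (Finset.univ.filter fun a => polyEvalHom P D V a ∈ B).card = B.card * κ := by
    intro B
    rw [Finset.card_eq_sum_card_fiberwise (f := polyEvalHom P D V) (t := B)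
      (fun a ha => by simpa using ha)]
    rw [Finset.sum_const_nat (m := κ)]
    intro b hb
    rw [hκ, ← AddMonoidHom.card_fiber_eq_of_mem_range (polyEvalHom P D V) (hs b) (hs 0)]
    congr 1
    ext a
    simp only [Finset.mem_filter, Finset.mem_univ, true_and]
    exact ⟨fun h => h.2, fun h => ⟨h ▸ hb, h⟩⟩
  have huniv := hfib Finset.univ
  simp only [Finset.mem_univ, Finset.filter_true, Finset.card_univ, Fintype.card_fun,
    Fintype.card_fin, ZMod.card, Fintype.card_coe] at huniv
  rw [hfib, huniv]
  ring

theorem card_val_lt {T : ℕ} (hT : T ≤ P) :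
    (Finset.univ.filter fun y : ZMod P => y.val < T).card = T := by
  rw [← Finset.card_range T]
  refine Finset.card_bij (fun y _ => y.val) ?_ ?_ ?_
  · intro y hy
    simpa using hy
  · intro y _ z _ h
    exact ZMod.val_injective P h
  · intro t ht
    have ht' : t < T := Finset.mem_range.1 ht
    have hv : ((t : ZMod P)).val = t := by
      rw [ZMod.val_natCast, Nat.mod_eq_of_lt (ht'.trans_le hT)]
    exact ⟨t, by simp [hv, ht'], hv⟩

theorem card_forall_polyEval_lt {V : Finset ℕ} (hV : ∀ x ∈ V, x < P) (hD : V.card ≤ D) {T : ℕ}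
    (hT : T ≤ P) :
    (Finset.univ.filter fun a : Fin D → ZMod P => ∀ x ∈ V, (polyEval a x).val < T).card
      * P ^ V.card = T ^ V.card * P ^ D := by
  classical
  have h := card_polyEvalHom_preimage hV hD
    (Fintype.piFinset fun _ : V => Finset.univ.filter fun y : ZMod P => y.val < T)
  rw [Fintype.card_piFinset, Finset.prod_const, card_val_lt hT, Finset.card_univ, Fintype.card_coe] at h
  rw [← h]
  congr 2
  ext a
  simp [polyEvalHom]

/-- Double counting of pairs of a seed and a `v`-subset of `U` that is sampled entirely. Up to order
`D`, the binomial moments of the sample size are those of fully independent sampling with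
probability `T / P`. -/
theorem sum_choose_card_sampleOf {U : Finset ℕ} (hU : ∀ x ∈ U, x < P) {T : ℕ} (hT : T ≤ P)
    {v : ℕ} (hv : v ≤ D) :
    (∑ a : Fin D → ZMod P, (sampleOf T a U).card.choose v) * P ^ v
      = U.card.choose v * T ^ v * P ^ D := by
  classical
  have h1 : ∀ a : Fin D → ZMod P, (sampleOf T a U).card.choose v =
      ((U.powersetCard v).filter fun V => ∀ x ∈ V, (polyEval a x).val < T).card := by
    intro a
    rw [← Finset.card_powersetCard]
    congr 1
    ext V
    simp only [Finset.mem_powersetCard, Finset.mem_filter, sampleOf, Finset.subset_iff]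
    exact ⟨fun h => ⟨⟨fun x hx => (h.1 hx).1, h.2⟩, fun x hx => (h.1 hx).2⟩,
      fun h => ⟨fun x hx => ⟨h.1.1 hx, h.2 x hx⟩, h.1.2⟩⟩
  simp_rw [h1]
  have h2 := Finset.sum_card_bipartiteAbove_eq_sum_card_bipartiteBelow
    (s := (Finset.univ : Finset (Fin D → ZMod P))) (t := U.powersetCard v)
    (fun a V => ∀ x ∈ V, (polyEval a x).val < T)
  simp only [Finset.bipartiteAbove, Finset.bipartiteBelow] at h2
  rw [h2, Finset.sum_mul, mul_assoc, ← Finset.card_powersetCard, ← smul_eq_mul,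
    ← Finset.sum_const]
  refine Finset.sum_congr rfl fun V hV => ?_
  obtain ⟨hVU, hVc⟩ := Finset.mem_powersetCard.1 hV
  have := card_forall_polyEval_lt (D := D) (fun x hx => hU x (hVU hx)) (hVc.trans_le hv) hT
  rwa [hVc] at this

/-- The seeds that sample far too many elements of `U`. -/
def overSampling (P D T : ℕ) [Fact P.Prime] (U : Finset ℕ) : Finset (Fin D → ZMod P) :=
  Finset.univ.filter fun a =>
    4 * D ≤ (sampleOf T a U).card ∧ 4 * (U.card * T) ≤ (sampleOf T a U).card * P

/-- The seeds that sample far too few elements of `U`. -/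
def underSampling (P D T : ℕ) [Fact P.Prime] (U : Finset ℕ) : Finset (Fin D → ZMod P) :=
  Finset.univ.filter fun a => 2 * ((sampleOf T a U).card * P) < U.card * T

/-- Markov's inequality for the `D`-th binomial moment, with `t` the smallest sample size among the
bad seeds. -/
theorem card_overSampling_le {U : Finset ℕ} (hU : ∀ x ∈ U, x < P) {T : ℕ} (hT : T ≤ P)
    (hD : 0 < D) : (overSampling P D T U).card * 2 ^ D ≤ P ^ D := by
  classical
  rcases (overSampling P D T U).eq_empty_or_nonempty with h0 | hne
  · simp [h0]
  obtain ⟨a₀, ha₀, hmin⟩ := Finset.exists_min_image _ (fun a => (sampleOf T a U).card) hne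
  set t := (sampleOf T a₀ U).card
  simp only [overSampling, Finset.mem_filter, Finset.mem_univ, true_and] at ha₀
  obtain ⟨hDt, hNt⟩ := ha₀
  have hPpos : 0 < P := (Fact.out : P.Prime).pos
  have hsum : (overSampling P D T U).card * t.choose D ≤ U.card.choose D * T ^ D := by
    have h := sum_choose_card_sampleOf hU hT (le_refl D)
    have h' := Nat.eq_of_mul_eq_mul_right (pow_pos hPpos D) h
    rw [← h', ← smul_eq_mul, ← Finset.sum_const]
    refine (Finset.sum_le_sum fun a ha => Nat.choose_le_choose D (hmin a ha)).trans ?_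
    exact Finset.sum_le_sum_of_subset (Finset.subset_univ _)
  have hdesc : (overSampling P D T U).card * (t + 1 - D) ^ D ≤ (U.card * T) ^ D := by
    calc (overSampling P D T U).card * (t + 1 - D) ^ D
        ≤ (overSampling P D T U).card * t.descFactorial D := by
          gcongr; exact Nat.pow_sub_le_descFactorial t D
      _ = D.factorial * ((overSampling P D T U).card * t.choose D) := by
          rw [Nat.descFactorial_eq_factorial_mul_choose]; ring
      _ ≤ D.factorial * (U.card.choose D * T ^ D) := by gcongr
      _ = U.card.descFactorial D * T ^ D := by
          rw [Nat.descFactorial_eq_factorial_mul_choose]; ring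
      _ ≤ U.card ^ D * T ^ D := by gcongr; exact Nat.descFactorial_le_pow _ _
      _ = (U.card * T) ^ D := by rw [mul_pow]
  -- As `t ≥ 4 * D`, each factor of the falling factorial of `t` is at least `t / 2`. Of the factor
  -- 4 in `overSampling` a factor 2 is left, which yields `2 ^ D`.
  have hhalf : 2 * (U.card * T) ≤ (t + 1 - D) * P := by
    have h1 : t ≤ 2 * (t + 1 - D) := by omega
    have h2 : t * P ≤ 2 * (t + 1 - D) * P := Nat.mul_le_mul_right P h1
    linarith [hNt]
  have hpos : 0 < (t + 1 - D) ^ D := pow_pos (by omega) D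
  refine Nat.le_of_mul_le_mul_right ?_ hpos
  calc (overSampling P D T U).card * 2 ^ D * (t + 1 - D) ^ D
      = 2 ^ D * ((overSampling P D T U).card * (t + 1 - D) ^ D) := by ring
    _ ≤ 2 ^ D * (U.card * T) ^ D := by gcongr
    _ = (2 * (U.card * T)) ^ D := by rw [← mul_pow]
    _ ≤ ((t + 1 - D) * P) ^ D := by gcongr
    _ = P ^ D * (t + 1 - D) ^ D := by rw [mul_pow]; ring

/-- Chebyshev's inequality from the first two binomial moments: the variance is at most the mean,
which is at least 8, so falling below half the mean has probability at most `4 / 8`. -/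
theorem card_underSampling_le {U : Finset ℕ} (hU : ∀ x ∈ U, x < P) {T : ℕ} (hT : T ≤ P)
    (hD : 2 ≤ D) (hUT : 8 * P ≤ U.card * T) :
    (underSampling P D T U).card * 2 ≤ P ^ D := by
  classical
  have hPpos : 0 < P := (Fact.out : P.Prime).pos
  set N : ℝ := (U.card : ℝ)
  set X : (Fin D → ZMod P) → ℝ := fun a => ((sampleOf T a U).card : ℝ) with hX
  have hP : (0 : ℝ) < P := by exact_mod_cast hPpos
  have h1 : (∑ a, X a) * P = N * T * (P : ℝ) ^ D := by
    have h := sum_choose_card_sampleOf hU hT (show 1 ≤ D by omega)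
    simp only [Nat.choose_one_right, pow_one] at h
    simp only [hX, N]
    exact_mod_cast h
  have h2 : (∑ a, X a * (X a - 1)) * (P : ℝ) ^ 2 = N * (N - 1) * (T : ℝ) ^ 2 * (P : ℝ) ^ D := by
    have h := congrArg (Nat.cast : ℕ → ℝ) (sum_choose_card_sampleOf hU hT hD)
    push_cast [Nat.cast_choose_two] at h
    rw [← Finset.sum_div] at h
    simp only [hX, N]
    linarith
  have hvar : ∑ a, (N * T - X a * P) ^ 2 ≤ N * T * P * (P : ℝ) ^ D := by
    have hc : (∑ _a : Fin D → ZMod P, (1 : ℝ)) = (P : ℝ) ^ D := by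
      simp [ZMod.card]
    have hexp : ∑ a, (N * T - X a * P) ^ 2 = N ^ 2 * (T : ℝ) ^ 2 * (∑ _a : Fin D → ZMod P, (1 : ℝ))
        - 2 * N * T * ((∑ a, X a) * P) + (∑ a, X a * (X a - 1)) * (P : ℝ) ^ 2
        + P * ((∑ a, X a) * P) := by
      simp only [Finset.mul_sum, Finset.sum_mul]
      rw [← Finset.sum_sub_distrib, ← Finset.sum_add_distrib, ← Finset.sum_add_distrib]
      exact Finset.sum_congr rfl fun a _ => by ring
    rw [hexp, h1, h2, hc]
    have : 0 ≤ N * (T : ℝ) ^ 2 * (P : ℝ) ^ D := by positivity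
    nlinarith
  have hbad : ((underSampling P D T U).card : ℝ) * (N * T / 2) ^ 2
      ≤ ∑ a, (N * T - X a * P) ^ 2 := by
    rw [← nsmul_eq_mul, ← Finset.sum_const]
    refine (Finset.sum_le_sum fun a ha => ?_).trans
      (Finset.sum_le_sum_of_subset_of_nonneg (Finset.subset_univ (underSampling P D T U))
        fun a _ _ => sq_nonneg _)
    have ha' : 2 * ((sampleOf T a U).card * P) < U.card * T := by
      simpa [underSampling] using ha
    have ha'' : 2 * (X a * P) < N * T := by
      simp only [hX, N]
      exact_mod_cast ha'
    have : 0 ≤ N * T := by positivity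
    exact pow_le_pow_left₀ (by positivity) (by linarith) 2
  have hNT : 8 * (P : ℝ) ≤ N * T := by
    simp only [N]
    exact_mod_cast hUT
  have hNTpos : 0 < N * T := by linarith
  have hfin : ((underSampling P D T U).card : ℝ) * 2 ≤ (P : ℝ) ^ D := by
    have hb : 0 ≤ ((underSampling P D T U).card : ℝ) := by positivity
    have h3 : ((underSampling P D T U).card : ℝ) * (N * T) * (N * T)
        ≤ 4 * P * (P : ℝ) ^ D * (N * T) := by nlinarith [hbad.trans hvar]
    have h4 := le_of_mul_le_mul_right h3 hNTpos
    have h5 : ((underSampling P D T U).card : ℝ) * (8 * P) ≤ 4 * P * (P : ℝ) ^ D :=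
      (mul_le_mul_of_nonneg_left hNT hb).trans h4
    have h6 : (((underSampling P D T U).card : ℝ) * 2) * (4 * P) ≤ (P : ℝ) ^ D * (4 * P) := by
      linarith
    exact le_of_mul_le_mul_right h6 (by positivity)
  exact_mod_cast hfin

end Hash


/-! ### Parameters -/

section Parameters

variable (c : ℕ) (p : ℕ × ℕ × ℕ)

theorem lt_two_pow_lgSize : p.1 + p.2.1 + 1 < 2 ^ lgSize p := by
  set N := p.1 + p.2.1 + 1 with hN
  by_contra! h
  have hle : lgSize p ≤ N := (Nat.lt_two_pow_self.le).trans h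
  have := Nat.le_findGreatest (P := fun l => decide (2 ^ l ≤ p.1 + p.2.1 + 1) = true)
    (m := lgSize p) (n := p.1 + p.2.1 + 1) hle (by simpa using h)
  unfold lgSize at this
  omega

theorem two_pow_lgSize_le : 2 ^ lgSize p ≤ 2 * (p.1 + p.2.1 + 1) := by
  have h := Nat.findGreatest_spec (P := fun l => decide (2 ^ l ≤ p.1 + p.2.1 + 1) = true)
    (m := 0) (n := p.1 + p.2.1 + 1) (Nat.zero_le _) (by simp)
  simp only [decide_eq_true_eq] at h
  unfold lgSize
  simp only [decide_eq_true_eq]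
  rw [pow_succ]
  omega

theorem lgSize_pos : 0 < lgSize p := Nat.succ_pos _

theorem fieldSize_spec :
    (fieldSize p).Prime ∧ 2 ^ lgSize p < fieldSize p ∧ fieldSize p ≤ 2 * 2 ^ lgSize p := by
  obtain ⟨q, hq, hlt, hle⟩ := Nat.exists_prime_lt_and_le_two_mul (2 ^ lgSize p) (by positivity)
  have h1 := Nat.findGreatest_spec (P := fun q => decide q.Prime = true) hle (by simpa using hq)
  have h2 := Nat.le_findGreatest (P := fun q => decide q.Prime = true) hle (by simpa using hq)
  exact ⟨by simpa [fieldSize] using h1, hlt.trans_le h2, Nat.findGreatest_le _⟩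

instance : Fact (fieldSize p).Prime := ⟨(fieldSize_spec p).1⟩

theorem fieldSize_pos : 0 < fieldSize p := (fieldSize_spec p).1.pos

theorem indep_pos {p : ℕ × ℕ × ℕ} (hk : 1 ≤ p.2.2) : 0 < indep c p := by
  have := lgSize_pos p
  unfold indep
  positivity

theorem rate_ge {p : ℕ × ℕ × ℕ} (hk : 1 ≤ p.2.2) : 512 ≤ rate c p := by
  have h1 := lgSize_pos p
  have h2 := indep_pos c hk
  unfold rate
  nlinarith

theorem scale_pos (i : ℕ) : 0 < scale c p i := lt_max_of_lt_left (by positivity)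

theorem threshold_mul_scale_le (i : ℕ) :
    threshold c p i * scale c p i ≤ fieldSize p * rate c p :=
  Nat.div_mul_le_self _ _

theorem threshold_le (i : ℕ) : threshold c p i ≤ fieldSize p := by
  refine Nat.div_le_of_le_mul ?_
  rw [mul_comm (scale c p i)]
  exact Nat.mul_le_mul_left _ (le_max_right _ _)

/-- For guesses up to `rate` nothing is sampled away, so these levels count exactly and need no
probabilistic argument. -/
theorem threshold_eq_fieldSize {p : ℕ × ℕ × ℕ} (hk : 1 ≤ p.2.2) {i : ℕ}
    (hi : 2 ^ (i + 1) ≤ rate c p) : threshold c p i = fieldSize p := by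
  unfold threshold scale
  rw [max_eq_right hi]
  exact Nat.mul_div_cancel _ (by have := rate_ge c hk; omega)

/-- Rounding down costs at most a factor 2 because the quotient defining `threshold` is at least 1;
this is why the field has more than `2 ^ lgSize p` elements. -/
theorem le_two_mul_threshold_mul_scale {p : ℕ × ℕ × ℕ} (hk : 1 ≤ p.2.2) {i : ℕ}
    (hi : i < lgSize p) :
    fieldSize p * rate c p ≤ 2 * (threshold c p i * scale c p i) := by
  have hμ := rate_ge c hk
  have hP := (fieldSize_spec p).2.1
  have hle : scale c p i ≤ fieldSize p * rate c p := by
    refine max_le ?_ (Nat.le_mul_of_pos_left _ (fieldSize_pos p))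
    calc 2 ^ (i + 1) ≤ 2 ^ lgSize p := Nat.pow_le_pow_right (by norm_num) hi
      _ ≤ fieldSize p := hP.le
      _ ≤ fieldSize p * rate c p := Nat.le_mul_of_pos_right _ (by omega)
  have h1 : 1 ≤ threshold c p i := (Nat.one_le_div_iff (scale_pos c p i)).2 hle
  have h2 : fieldSize p * rate c p < threshold c p i * scale c p i + scale c p i :=
    Nat.lt_div_mul_add (scale_pos c p i)
  have h3 : scale c p i ≤ threshold c p i * scale c p i := Nat.le_mul_of_pos_left _ h1
  omega

end Parameters

/-! ### Families of seeds -/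

section Families

variable {α ι : Type*} [Fintype α] [DecidableEq α] {R : ℕ}

theorem card_apply_mem (ρ : Fin R) (B : Finset α) :
    (Finset.univ.filter fun s : Fin R → α => s ρ ∈ B).card * Fintype.card α
      = B.card * Fintype.card α ^ R := by
  have h : (Finset.univ.filter fun s : Fin R → α => s ρ ∈ B)
      = Fintype.piFinset fun ρ' => if ρ' = ρ then B else Finset.univ := by
    ext s
    simp only [Finset.mem_filter, Finset.mem_univ, true_and, Fintype.mem_piFinset]
    refine ⟨fun hs ρ' => ?_, fun hs => by simpa using hs ρ⟩
    split_ifs with h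
    · exact h ▸ hs
    · exact Finset.mem_univ _
  have h2 : Fintype.card α ^ R = ∏ _ρ : Fin R, Fintype.card α := by simp
  rw [h, Fintype.card_piFinset, h2, Fintype.prod_eq_mul_prod_compl ρ,
    Fintype.prod_eq_mul_prod_compl ρ, if_pos rfl]
  have h3 : ∏ i ∈ ({ρ} : Finset (Fin R))ᶜ, (if i = ρ then B else Finset.univ).card
      = ∏ _i ∈ ({ρ} : Finset (Fin R))ᶜ, Fintype.card α := by
    refine Finset.prod_congr rfl fun i hi => ?_
    rw [if_neg (by simpa using hi), Finset.card_univ]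
  rw [h3]
  ring

/-- Union bound over all coordinates and all bad sets. -/
theorem card_exists_mem_le [Nonempty α] (Q : Finset ι) (B : ι → Finset α) {w : ℕ}
    (hB : ∀ q ∈ Q, (B q).card * w ≤ Fintype.card α) :
    (Finset.univ.filter fun s : Fin R → α => ∃ ρ, ∃ q ∈ Q, s ρ ∈ B q).card * w
      ≤ R * Q.card * Fintype.card α ^ R := by
  classical
  have hα : 0 < Fintype.card α := Fintype.card_pos
  have hsub : (Finset.univ.filter fun s : Fin R → α => ∃ ρ, ∃ q ∈ Q, s ρ ∈ B q) ⊆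
      (Finset.univ ×ˢ Q).biUnion fun x : Fin R × ι =>
        Finset.univ.filter fun s : Fin R → α => s x.1 ∈ B x.2 := by
    intro s hs
    obtain ⟨ρ, q, hq, h⟩ := (Finset.mem_filter.1 hs).2
    exact Finset.mem_biUnion.2 ⟨(ρ, q), by simp [hq], by simpa using h⟩
  refine Nat.le_of_mul_le_mul_right ?_ hα
  calc (Finset.univ.filter fun s : Fin R → α => ∃ ρ, ∃ q ∈ Q, s ρ ∈ B q).card * w
        * Fintype.card α
      ≤ (∑ x ∈ Finset.univ ×ˢ Q, (Finset.univ.filter fun s : Fin R → α =>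
          s x.1 ∈ B x.2).card) * w * Fintype.card α := by
        gcongr
        exact (Finset.card_le_card hsub).trans Finset.card_biUnion_le
    _ = ∑ x ∈ (Finset.univ : Finset (Fin R)) ×ˢ Q,
          (B x.2).card * w * Fintype.card α ^ R := by
        rw [Finset.sum_mul, Finset.sum_mul]
        refine Finset.sum_congr rfl fun x _ => ?_
        rw [mul_right_comm, card_apply_mem]
        ring
    _ ≤ ∑ _x ∈ (Finset.univ : Finset (Fin R)) ×ˢ Q, Fintype.card α * Fintype.card α ^ R := by
        refine Finset.sum_le_sum fun x hx => ?_
        exact Nat.mul_le_mul_right _ (hB _ (Finset.mem_product.1 hx).2)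
    _ = R * Q.card * Fintype.card α ^ R * Fintype.card α := by
        rw [Finset.sum_const, Finset.card_product, Finset.card_univ, Fintype.card_fin, smul_eq_mul]
        ring

/-- Independence of the coordinates: the failure probability `1 / w` of one repetition becomes `1 /
w ^ R`. -/
theorem card_forall_mem_le (B : Finset α) {w : ℕ} (hB : B.card * w ≤ Fintype.card α) :
    (Finset.univ.filter fun s : Fin R → α => ∀ ρ, s ρ ∈ B).card * w ^ R
      ≤ Fintype.card α ^ R := by
  have h : (Finset.univ.filter fun s : Fin R → α => ∀ ρ, s ρ ∈ B)
      = Fintype.piFinset fun _ => B := by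
    ext s; simp
  rw [h, Fintype.card_piFinset, Finset.prod_const, Finset.card_univ, Fintype.card_fin, ← mul_pow]
  exact Nat.pow_le_pow_left hB R

end Families

/-! ### Digits of a random number -/

section Digits

theorem mod_pow_eq_of_digits_eq {P x y : ℕ} {N : ℕ}
    (h : ∀ b < N, x / P ^ b % P = y / P ^ b % P) : x % P ^ N = y % P ^ N := by
  induction N with
  | zero => simp [Nat.mod_one]
  | succ N ih =>
    rw [Nat.mod_pow_succ, Nat.mod_pow_succ, ih fun b hb => h b (by omega), h N (by omega)]

/-- The coefficients of the hash functions given by the base `P` digits of `ω`. -/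
def digitCoeffs (P D ω ρ : ℕ) : Fin D → ZMod P := fun d => (ω / P ^ (d + D * ρ) % P : ℕ)

/-- The coins give a number uniform below a power of two, whose lowest `R * D` base `P` digits are
only nearly uniform. Each residue modulo `Q` occurs at most `W / Q + 1 ≤ 2 * W / Q` times, so
probabilities at most double. -/
theorem card_digitCoeffs_mem_le {P D R W : ℕ} [NeZero P] (hW : P ^ (R * D) ≤ W)
    (B : Finset (Fin R → Fin D → ZMod P)) :
    ((Finset.range W).filter fun ω => (fun ρ : Fin R => digitCoeffs P D ω ρ) ∈ B).card
      * P ^ (R * D) ≤ 2 * W * B.card := by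
  classical
  have hP : 0 < P := Nat.pos_of_ne_zero (NeZero.ne P)
  set Q := P ^ (R * D) with hQ
  have hQpos : 0 < Q := pow_pos hP _
  have hinj : ∀ x y : ℕ, (fun ρ : Fin R => digitCoeffs P D x ρ)
      = (fun ρ : Fin R => digitCoeffs P D y ρ) → x % Q = y % Q := by
    intro x y hxy
    refine mod_pow_eq_of_digits_eq fun b hb => ?_
    have hD : 0 < D := Nat.pos_of_ne_zero (by rintro rfl; simp at hb)
    have h := congrFun (congrFun hxy ⟨b / D, Nat.div_lt_of_lt_mul (by rwa [mul_comm])⟩)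
      ⟨b % D, Nat.mod_lt _ hD⟩
    have h' := congrArg ZMod.val h
    simpa only [digitCoeffs, Nat.mod_add_div, ZMod.val_natCast, Nat.mod_mod] using h'
  have hfib : ∀ s ∈ B, ((Finset.range W).filter fun ω =>
      (fun ρ : Fin R => digitCoeffs P D ω ρ) = s).card ≤ W / Q + 1 := by
    intro s _
    rw [← Finset.card_range (W / Q + 1)]
    refine Finset.card_le_card_of_injOn (fun ω => ω / Q) ?_ ?_
    · intro ω hω
      have : ω < W := by simpa using (Finset.mem_filter.1 hω).1
      simpa using Nat.lt_succ_of_le (Nat.div_le_div_right this.le)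
    · intro x hx y hy hxy
      have h := hinj x y ((Finset.mem_filter.1 hx).2.trans (Finset.mem_filter.1 hy).2.symm)
      rw [← Nat.mod_add_div x Q, ← Nat.mod_add_div y Q, h]
      exact congrArg (fun z => y % Q + Q * z) hxy
  have hsum := Finset.card_eq_sum_card_fiberwise
    (s := (Finset.range W).filter fun ω => (fun ρ : Fin R => digitCoeffs P D ω ρ) ∈ B)
    (f := fun ω => fun ρ : Fin R => digitCoeffs P D ω ρ)
    (t := B) (fun ω hω => (Finset.mem_filter.1 hω).2)
  rw [hsum]
  calc _ ≤ (∑ _s ∈ B, (W / Q + 1)) * Q := by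
        gcongr with s hs
        refine (Finset.card_le_card ?_).trans (hfib s hs)
        intro ω hω
        simp only [Finset.mem_filter] at hω ⊢
        exact ⟨hω.1.1, hω.2⟩
    _ = B.card * (W / Q * Q + Q) := by
        rw [Finset.sum_const, smul_eq_mul]; ring
    _ ≤ B.card * (W + W) := by
        gcongr
        exact Nat.div_mul_le_self W Q
    _ = 2 * W * B.card := by ring

end Digits

/-! ### Good seeds -/

section GoodSeed

variable (c : ℕ) (p : ℕ × ℕ × ℕ)

theorem hashValue_eq (ω ρ x : ℕ) : hashValue c p ω ρ x =
    (polyEval (digitCoeffs (fieldSize p) (indep c p) ω ρ) x).val := by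
  unfold hashValue polyEval digitCoeffs
  rw [← ZMod.val_natCast]
  push_cast
  rw [← Fin.sum_univ_eq_sum_range
    (fun d => ((ω / fieldSize p ^ (d + indep c p * ρ) % fieldSize p : ℕ) : ZMod (fieldSize p))
      * (x : ZMod (fieldSize p)) ^ d)]

/-- The hash functions given by `ω` never sample far too many elements of a set in `𝓤`, and one
of them does not sample far too few elements of `U₀` on level `i₀`. -/
def IsGoodSeed (𝓤 : Finset (Finset ℕ)) (i₀ : ℕ) (U₀ : Finset ℕ) (ω : ℕ) : Prop :=
  (∀ ρ < reps c p, ∀ i < lgSize p, rate c p < 2 ^ (i + 1) → ∀ U ∈ 𝓤,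
    digitCoeffs (fieldSize p) (indep c p) ω ρ ∉
      overSampling (fieldSize p) (indep c p) (threshold c p i) U) ∧
  ∃ ρ < reps c p, digitCoeffs (fieldSize p) (indep c p) ω ρ ∉
      underSampling (fieldSize p) (indep c p) (threshold c p i₀) U₀

variable {p}

/-- This fixes `reps`: all repetitions fail to sample enough of the optimum with probability at most
`1 / (4 m ^ c)`. -/
theorem four_mul_pow_le_two_pow_reps : 4 * p.2.1 ^ c ≤ 2 ^ reps c p := by
  have hN := lt_two_pow_lgSize p
  have hLpos := lgSize_pos p
  unfold reps
  generalize lgSize p = L at *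
  calc 4 * p.2.1 ^ c ≤ 2 ^ 2 * (2 ^ L) ^ c := by
        gcongr
        · norm_num
        · omega
    _ = 2 ^ (2 + L * c) := by rw [pow_add, pow_mul]
    _ ≤ 2 ^ ((c + 3) * L) := Nat.pow_le_pow_right (by norm_num) (by nlinarith)

/-- This fixes `indep`: the tail `2 ^ (-indep)` pays for the union bound over hash functions, levels
and up to `(m + 1) ^ k` coverages, and leaves `1 / (4 m ^ c)`. -/
theorem four_mul_le_two_pow_indep (hk : 1 ≤ p.2.2) {q : ℕ} (hq : q ≤ (p.2.1 + 1) ^ p.2.2) :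
    4 * (reps c p * (lgSize p * q)) * p.2.1 ^ c ≤ 2 ^ indep c p := by
  have hN := lt_two_pow_lgSize p
  have hLpos := lgSize_pos p
  unfold reps indep
  generalize lgSize p = L at *
  generalize p.2.2 = k at *
  have hkL : 1 ≤ k * L := Nat.mul_pos hk hLpos
  have hq' : q ≤ (2 ^ L) ^ k := hq.trans (Nat.pow_le_pow_left (by omega) _)
  have hc : c + 3 ≤ 2 ^ (c + 3) := Nat.lt_two_pow_self.le
  have hL : L ≤ 2 ^ L := Nat.lt_two_pow_self.le
  calc 4 * ((c + 3) * L * (L * q)) * p.2.1 ^ c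
      ≤ 2 ^ 2 * ((2 ^ (c + 3) * 2 ^ L) * (2 ^ L * (2 ^ L) ^ k)) * (2 ^ L) ^ c := by
        gcongr
        · norm_num
        · omega
    _ = 2 ^ (2 + ((c + 3 + L) + (L + L * k)) + L * c) := by
        simp only [pow_add, pow_mul]
    _ ≤ 2 ^ ((2 * c + 10) * k * L) := by
        refine Nat.pow_le_pow_right (by norm_num) ?_
        have e1 : L ≤ k * L := Nat.le_mul_of_pos_left _ hk
        have e2 : L * c ≤ k * L * c := Nat.mul_le_mul_right _ e1
        have e3 : c ≤ k * L * c := Nat.le_mul_of_pos_left _ hkL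
        have e4 : (2 * c + 10) * k * L = 2 * (k * L * c) + 10 * (k * L) := by ring
        have e5 : L * k = k * L := mul_comm _ _
        omega

theorem two_le_indep (hk : 1 ≤ p.2.2) : 2 ≤ indep c p := by
  have : 1 ≤ p.2.2 * lgSize p := Nat.mul_pos hk (lgSize_pos p)
  unfold indep
  rw [mul_assoc]
  nlinarith

theorem lt_fieldSize {x : ℕ} (hx : x < p.1) : x < fieldSize p := by
  have h1 := lt_two_pow_lgSize p
  have h2 := (fieldSize_spec p).2.1
  omega

/-- On exact levels the bad set is empty. On the others the expected sample size is at least `rate /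
4 ≥ 128`, well above the 8 needed for Chebyshev's inequality. -/
theorem card_underSampling_threshold_le (hk : 1 ≤ p.2.2) {i : ℕ} (hi : i < lgSize p)
    {U : Finset ℕ} (hU : ∀ x ∈ U, x < p.1) (hUc : 2 ^ i ≤ U.card) :
    (underSampling (fieldSize p) (indep c p) (threshold c p i) U).card * 2
      ≤ fieldSize p ^ indep c p := by
  rcases le_or_gt (2 ^ (i + 1)) (rate c p) with hle | hlt
  · have : underSampling (fieldSize p) (indep c p) (threshold c p i) U = ∅ := by
      refine Finset.filter_false_of_mem fun a _ => ?_
      have hs : sampleOf (threshold c p i) a U = U := by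
        refine Finset.filter_true_of_mem fun x _ => ?_
        rw [threshold_eq_fieldSize c hk hle]
        exact ZMod.val_lt _
      rw [hs, threshold_eq_fieldSize c hk hle]
      omega
    simp [this]
  · refine card_underSampling_le (fun x hx => lt_fieldSize (hU x hx)) (threshold_le c p _)
      (two_le_indep c hk) ?_
    have h1 := le_two_mul_threshold_mul_scale c hk hi
    have h2 := rate_ge c hk
    have h3 : scale c p i = 2 ^ (i + 1) := max_eq_left hlt.le
    rw [h3, pow_succ] at h1
    have h4 := Nat.mul_le_mul_left (fieldSize p) h2
    have h5 := Nat.mul_le_mul_right (threshold c p i) hUc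
    linarith

theorem fieldSize_pow_le :
    fieldSize p ^ (reps c p * indep c p) ≤ 2 ^ ((lgSize p + 1) * (reps c p * indep c p)) := by
  rw [pow_mul 2]
  refine Nat.pow_le_pow_left ?_ _
  have := (fieldSize_spec p).2.2
  rw [pow_succ]
  omega

-- Over uniform coefficients, oversampling and undersampling each have probability at most `1 / (4 m
-- ^ c)`. The passage to digits of a random number doubles the sum to `1 / m ^ c`.
open Classical in
theorem card_not_isGoodSeed_le (hk : 1 ≤ p.2.2) {𝓤 : Finset (Finset ℕ)}
    (h𝓤 : ∀ U ∈ 𝓤, ∀ x ∈ U, x < p.1) (hcard : 𝓤.card ≤ (p.2.1 + 1) ^ p.2.2)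
    {i₀ : ℕ} (hi₀ : i₀ < lgSize p) {U₀ : Finset ℕ} (hU₀ : ∀ x ∈ U₀, x < p.1)
    (hU₀c : 2 ^ i₀ ≤ U₀.card) :
    ((Finset.range (2 ^ ((lgSize p + 1) * (reps c p * indep c p)))).filter fun ω =>
      ¬ IsGoodSeed c p 𝓤 i₀ U₀ ω).card * p.2.1 ^ c
      ≤ 2 ^ ((lgSize p + 1) * (reps c p * indep c p)) := by
  have hQW := fieldSize_pow_le c (p := p)
  generalize hW : 2 ^ ((lgSize p + 1) * (reps c p * indep c p)) = W at *
  have hα : Fintype.card (Fin (indep c p) → ZMod (fieldSize p)) = fieldSize p ^ indep c p := by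
    simp [ZMod.card]
  have hαR : Fintype.card (Fin (indep c p) → ZMod (fieldSize p)) ^ reps c p
      = fieldSize p ^ (reps c p * indep c p) := by rw [hα, ← pow_mul, mul_comm]
  have hB₁ := card_exists_mem_le (R := reps c p) (Finset.range (lgSize p) ×ˢ 𝓤)
    (fun q => overSampling (fieldSize p) (indep c p) (threshold c p q.1) q.2)
    (w := 2 ^ indep c p) (fun q hq => by
      rw [hα]
      exact card_overSampling_le
        (fun x hx => lt_fieldSize (h𝓤 _ (Finset.mem_product.1 hq).2 x hx))
        (threshold_le c p _) (indep_pos c hk))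
  have hB₂ := card_forall_mem_le (R := reps c p)
    (underSampling (fieldSize p) (indep c p) (threshold c p i₀) U₀) (w := 2)
    (by rw [hα]; exact card_underSampling_threshold_le c hk hi₀ hU₀ hU₀c)
  rw [hαR] at hB₁ hB₂
  rw [Finset.card_product, Finset.card_range] at hB₁
  generalize hB₁def : (Finset.univ.filter fun s : Fin (reps c p) → Fin (indep c p) →
    ZMod (fieldSize p) => ∃ ρ, ∃ q ∈ Finset.range (lgSize p) ×ˢ 𝓤, s ρ ∈
      overSampling (fieldSize p) (indep c p) (threshold c p q.1) q.2) = B₁ at hB₁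
  generalize hB₂def : (Finset.univ.filter fun s : Fin (reps c p) → Fin (indep c p) →
    ZMod (fieldSize p) => ∀ ρ, s ρ ∈
      underSampling (fieldSize p) (indep c p) (threshold c p i₀) U₀) = B₂ at hB₂
  have hbad : ((Finset.range W).filter fun ω => ¬ IsGoodSeed c p 𝓤 i₀ U₀ ω) ⊆
      (Finset.range W).filter fun ω => (fun ρ : Fin (reps c p) =>
        digitCoeffs (fieldSize p) (indep c p) ω ρ) ∈ B₁ ∪ B₂ := by
    intro ω hω
    obtain ⟨hωW, hω⟩ := Finset.mem_filter.1 hω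
    refine Finset.mem_filter.2 ⟨hωW, ?_⟩
    by_contra hcon
    rw [Finset.mem_union, not_or, ← hB₁def, ← hB₂def] at hcon
    refine hω ⟨?_, ?_⟩
    · intro ρ hρ i hi hlt U hU hmem
      refine hcon.1 (Finset.mem_filter.2 ⟨Finset.mem_univ _, ⟨ρ, hρ⟩, (i, U), ?_, hmem⟩)
      exact Finset.mem_product.2 ⟨Finset.mem_range.2 hi, hU⟩
    · by_contra! hall
      exact hcon.2 (Finset.mem_filter.2 ⟨Finset.mem_univ _, fun ρ => hall ρ ρ.2⟩)
  have hcount := card_digitCoeffs_mem_le hQW (B₁ ∪ B₂)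
  have hunion := Finset.card_union_le B₁ B₂
  have hle := Finset.card_le_card hbad
  have hpos : 0 < fieldSize p ^ (reps c p * indep c p) := pow_pos (fieldSize_pos p) _
  have e1 := four_mul_le_two_pow_indep c hk hcard
  have e2 := four_mul_pow_le_two_pow_reps c (p := p)
  generalize ((Finset.range W).filter fun ω => ¬ IsGoodSeed c p 𝓤 i₀ U₀ ω).card = bad at *
  generalize ((Finset.range W).filter fun ω => (fun ρ : Fin (reps c p) =>
        digitCoeffs (fieldSize p) (indep c p) ω ρ) ∈ B₁ ∪ B₂).card = bad' at *
  generalize fieldSize p ^ (reps c p * indep c p) = Q at *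
  generalize p.2.1 ^ c = μ at *
  have h1 : 4 * B₁.card * μ ≤ Q := by
    refine Nat.le_of_mul_le_mul_right ?_ (pow_pos (show 0 < 2 by norm_num) (indep c p))
    calc 4 * B₁.card * μ * 2 ^ indep c p = 4 * μ * (B₁.card * 2 ^ indep c p) := by ring
      _ ≤ 4 * μ * (reps c p * (lgSize p * 𝓤.card) * Q) := by gcongr
      _ = Q * (4 * (reps c p * (lgSize p * 𝓤.card)) * μ) := by ring
      _ ≤ Q * 2 ^ indep c p := by gcongr
  have h2 : 4 * B₂.card * μ ≤ Q := by
    calc 4 * B₂.card * μ = B₂.card * (4 * μ) := by ring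
      _ ≤ B₂.card * 2 ^ reps c p := by gcongr
      _ ≤ Q := hB₂
  refine Nat.le_of_mul_le_mul_right ?_ hpos
  calc bad * μ * Q ≤ bad' * Q * μ := by rw [mul_right_comm]; gcongr
    _ ≤ 2 * W * (B₁ ∪ B₂).card * μ := by gcongr
    _ ≤ 2 * W * (B₁.card + B₂.card) * μ := by gcongr
    _ ≤ W * Q := by nlinarith

end GoodSeed


/-! ### From coverage to unique coverage -/

section UniqueFromCoverage

variable {ι β : Type*} [Fintype ι] [DecidableEq ι] [DecidableEq β]

/-- A function `f` encodes the random family `{i | f i = 0}`, which contains each index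
independently with probability `1 / (N + 1)`. The events that a given `a ∈ V` is the only chosen
index of `V` are disjoint and have product form. -/
theorem card_exactly_one_zero (V : Finset ι) (N : ℕ) :
    (Finset.univ.filter fun f : ι → Fin (N + 1) => (V.filter fun i => f i = 0).card = 1).card
      * (N + 1) ^ V.card = V.card * N ^ (V.card - 1) * (N + 1) ^ Fintype.card ι := by
  classical
  let A : ι → Finset (ι → Fin (N + 1)) := fun a => Fintype.piFinset fun i =>
    if i = a then {0} else if i ∈ V then {0}ᶜ else Finset.univ
  have hA : ∀ a ∈ V, (A a).card * (N + 1) ^ V.card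
      = N ^ (V.card - 1) * (N + 1) ^ Fintype.card ι := by
    intro a ha
    have h1 : ∏ i ∈ V, (if i = a then {0} else if i ∈ V then {0}ᶜ else Finset.univ :
        Finset (Fin (N + 1))).card = N ^ (V.card - 1) := by
      rw [← Finset.mul_prod_erase V _ ha, ← Finset.card_erase_of_mem ha, ← Finset.prod_const]
      simp only [if_true, Finset.card_singleton, one_mul]
      refine Finset.prod_congr rfl fun i hi => ?_
      rw [if_neg (Finset.ne_of_mem_erase hi), if_pos (Finset.mem_of_mem_erase hi),
        Finset.card_compl, Fintype.card_fin, Finset.card_singleton, Nat.add_sub_cancel]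
    have h2 : ∏ i ∈ Vᶜ, (if i = a then {0} else if i ∈ V then {0}ᶜ else Finset.univ :
        Finset (Fin (N + 1))).card = (N + 1) ^ Vᶜ.card := by
      rw [← Finset.prod_const]
      refine Finset.prod_congr rfl fun i hi => ?_
      have hi' : i ∉ V := Finset.mem_compl.1 hi
      rw [if_neg (ne_of_mem_of_not_mem ha hi').symm, if_neg hi', Finset.card_univ, Fintype.card_fin]
    rw [Fintype.card_piFinset, ← Finset.prod_mul_prod_compl V, h1, h2, mul_assoc, ← pow_add,
      Finset.card_compl_add_card]
  have hU : (Finset.univ.filter fun f : ι → Fin (N + 1) =>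
      (V.filter fun i => f i = 0).card = 1) = V.biUnion A := by
    ext f
    simp only [Finset.mem_filter, Finset.mem_univ, true_and, Finset.mem_biUnion, A,
      Fintype.mem_piFinset, Finset.card_eq_one]
    constructor
    · rintro ⟨a, ha⟩
      have haV := Finset.mem_filter.1 (ha ▸ Finset.mem_singleton_self a)
      refine ⟨a, haV.1, fun i => ?_⟩
      split_ifs with h1 h2
      · simpa [h1] using haV.2
      · simp only [Finset.mem_compl, Finset.mem_singleton]
        intro h0
        have : i ∈ V.filter fun i => f i = 0 := Finset.mem_filter.2 ⟨h2, h0⟩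
        rw [ha, Finset.mem_singleton] at this
        exact h1 this
      · exact Finset.mem_univ _
    · rintro ⟨a, ha, hf⟩
      refine ⟨a, Finset.eq_singleton_iff_unique_mem.2 ⟨?_, fun i hi => ?_⟩⟩
      · exact Finset.mem_filter.2 ⟨ha, by simpa using hf a⟩
      · obtain ⟨hiV, hi0⟩ := Finset.mem_filter.1 hi
        by_contra hne
        have := hf i
        rw [if_neg hne, if_pos hiV] at this
        simp [hi0] at this
  have hdisj : ∀ a ∈ V, ∀ b ∈ V, a ≠ b → Disjoint (A a) (A b) := by
    intro a ha b hb hab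
    rw [Finset.disjoint_left]
    intro f hfa hfb
    have h1 := Fintype.mem_piFinset.1 hfa a
    have h2 := Fintype.mem_piFinset.1 hfb a
    rw [if_pos rfl] at h1
    rw [if_neg hab, if_pos ha] at h2
    exact (Finset.mem_compl.1 h2) h1
  rw [hU, Finset.card_biUnion hdisj, Finset.sum_mul, Finset.sum_congr rfl hA, Finset.sum_const,
    smul_eq_mul, mul_assoc]

/-- An element of degree `d` is uniquely covered with probability `d / (N + 1) * (1 - 1 / (N + 1)) ^
(d - 1)`. The first factor is at least 1/4 by hypothesis, the second at least 1/2 by Bernoulli's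
inequality. -/
theorem pow_le_eight_mul {d N : ℕ} (h1 : N + 1 ≤ 4 * d) (h2 : 2 * d ≤ N + 1) :
    (N + 1) ^ d ≤ 8 * (d * N ^ (d - 1)) := by
  obtain ⟨e, rfl⟩ : ∃ e, d = e + 1 := ⟨d - 1, by omega⟩
  have hb : ((N : ℝ) + 1) ^ e ≤ 2 * (N : ℝ) ^ e := by
    have hpos : (0 : ℝ) < N + 1 := by positivity
    have h := one_add_mul_le_pow (a := -1 / ((N : ℝ) + 1)) (by
      rw [le_div_iff₀ hpos]; linarith [(Nat.cast_nonneg N : (0 : ℝ) ≤ N)]) e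
    have h3 : 1 + -1 / ((N : ℝ) + 1) = N / (N + 1) := by field_simp; ring
    rw [h3, div_pow, le_div_iff₀ (by positivity)] at h
    have h4 : (1 : ℝ) / 2 ≤ 1 + e * (-1 / ((N : ℝ) + 1)) := by
      have h5 : (2 : ℝ) * (e + 1) ≤ N + 1 := by exact_mod_cast h2
      have : (e : ℝ) / (N + 1) ≤ 1 / 2 := by
        rw [div_le_iff₀ hpos]; linarith
      have h6 : (e : ℝ) * (-1 / ((N : ℝ) + 1)) = - (e / (N + 1)) := by ring
      rw [h6]; linarith
    have h7 := mul_le_mul_of_nonneg_right h4 (pow_pos hpos e).le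
    linarith
  have hb' : (N + 1) ^ e ≤ 2 * N ^ e := by exact_mod_cast hb
  rw [Nat.add_sub_cancel, pow_succ]
  calc (N + 1) ^ e * (N + 1) ≤ 2 * N ^ e * (4 * (e + 1)) := Nat.mul_le_mul hb' h1
    _ = _ := by ring

/-- Averaging over the random family: each element of `W` is uniquely covered with probability at
least 1/8, so some family attains this fraction. -/
theorem exists_subfamily_of_degree_le {S : ι → Finset β} {W : Finset β} {N : ℕ}
    (h1 : ∀ x ∈ W, N + 1 ≤ 4 * (Finset.univ.filter fun i => x ∈ S i).card)
    (h2 : ∀ x ∈ W, 2 * (Finset.univ.filter fun i => x ∈ S i).card ≤ N + 1) :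
    ∃ J : Finset ι, W.card ≤ 8 * (W.filter fun x => (J.filter fun i => x ∈ S i).card = 1).card := by
  classical
  by_contra! hcon
  let J : (ι → Fin (N + 1)) → Finset ι := fun f => Finset.univ.filter fun i => f i = 0
  have hlow : ∀ x ∈ W, (N + 1) ^ Fintype.card ι ≤
      8 * (Finset.univ.filter fun f : ι → Fin (N + 1) =>
        ((J f).filter fun i => x ∈ S i).card = 1).card := by
    intro x hx
    have h := card_exactly_one_zero (Finset.univ.filter fun i => x ∈ S i) N
    have hp := pow_le_eight_mul (h1 x hx) (h2 x hx)
    have hJ : ∀ f : ι → Fin (N + 1), (J f).filter (fun i => x ∈ S i)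
        = (Finset.univ.filter fun i => x ∈ S i).filter fun i => f i = 0 := fun f => by
      simp only [J, Finset.filter_comm]
    simp only [hJ]
    refine Nat.le_of_mul_le_mul_right ?_
      (pow_pos (Nat.succ_pos N) (Finset.univ.filter fun i => x ∈ S i).card)
    rw [mul_assoc 8, h, mul_comm]
    calc _ ≤ 8 * _ * (N + 1) ^ Fintype.card ι := Nat.mul_le_mul_right _ hp
      _ = _ := by ring
  have hdouble := Finset.sum_card_bipartiteAbove_eq_sum_card_bipartiteBelow
    (s := W) (t := (Finset.univ : Finset (ι → Fin (N + 1))))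
    (fun x f => ((J f).filter fun i => x ∈ S i).card = 1)
  simp only [Finset.bipartiteAbove, Finset.bipartiteBelow] at hdouble
  have hsum : W.card * (N + 1) ^ Fintype.card ι ≤ 8 * ∑ x ∈ W, (Finset.univ.filter fun f :
      ι → Fin (N + 1) => ((J f).filter fun i => x ∈ S i).card = 1).card := by
    rw [Finset.mul_sum, ← smul_eq_mul, ← Finset.sum_const]
    exact Finset.sum_le_sum hlow
  rw [hdouble, Finset.mul_sum] at hsum
  have hlt : ∑ f : ι → Fin (N + 1), 8 * (W.filter fun x =>
      ((J f).filter fun i => x ∈ S i).card = 1).card < ∑ _f : ι → Fin (N + 1), W.card :=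
    Finset.sum_lt_sum_of_nonempty Finset.univ_nonempty fun f _ => hcon (J f)
  rw [Finset.sum_const, Finset.card_univ, Fintype.card_fun, Fintype.card_fin, smul_eq_mul] at hlt
  linarith

theorem exists_subfamily_uniquely_covering {S : ι → Finset β} {d : ℕ}
    (hd : ∀ x, (Finset.univ.filter fun i => x ∈ S i).card ≤ d) :
    ∃ J : Finset ι, (Finset.univ.biUnion S).card ≤ 8 * (1 + Nat.log 2 d) *
      ((Finset.univ.biUnion S).filter fun x => (J.filter fun i => x ∈ S i).card = 1).card := by
  classical
  set U := Finset.univ.biUnion S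
  let deg : β → ℕ := fun x => (Finset.univ.filter fun i => x ∈ S i).card
  obtain ⟨t, -, ht⟩ : ∃ t ∈ Finset.range (1 + Nat.log 2 d),
      U.card ≤ (1 + Nat.log 2 d) * (U.filter fun x => Nat.log 2 (deg x) = t).card := by
    by_contra! hcon
    have hmaps : ∀ x ∈ U, Nat.log 2 (deg x) ∈ Finset.range (1 + Nat.log 2 d) := fun x _ =>
      Finset.mem_range.2 (by have := Nat.log_mono_right (b := 2) (hd x); simp only [deg]; omega)
    have hs := Finset.card_eq_sum_card_fiberwise hmaps
    have hlt := Finset.sum_lt_sum_of_nonempty (s := Finset.range (1 + Nat.log 2 d)) (by simp) hcon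
    rw [← Finset.mul_sum, ← hs, Finset.sum_const, Finset.card_range, smul_eq_mul] at hlt
    exact lt_irrefl _ hlt
  have hdeg : ∀ x ∈ U, deg x ≠ 0 := by
    intro x hx
    obtain ⟨i, -, hi⟩ := Finset.mem_biUnion.1 hx
    exact (Finset.card_pos.2 ⟨i, by simpa using hi⟩).ne'
  -- Degrees in the chosen class lie in `[2 ^ t, 2 ^ (t + 1))`, so the sampling probability `2 ^
  -- (-(t + 2))` is between `1 / (4 * deg)` and `1 / (2 * deg)`.
  obtain ⟨N, hN⟩ : ∃ N, 2 ^ (t + 2) = N + 1 := ⟨2 ^ (t + 2) - 1, by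
    have : 0 < 2 ^ (t + 2) := by positivity
    omega⟩
  obtain ⟨J, hJ⟩ := exists_subfamily_of_degree_le (S := S)
    (W := U.filter fun x => Nat.log 2 (deg x) = t) (N := N)
    (fun x hx => by
      obtain ⟨hxU, hxt⟩ := Finset.mem_filter.1 hx
      have h := Nat.pow_log_le_self 2 (hdeg x hxU)
      rw [hxt] at h
      rw [← hN, pow_add]
      simp only [deg] at h
      omega)
    (fun x hx => by
      obtain ⟨hxU, hxt⟩ := Finset.mem_filter.1 hx
      have h := Nat.lt_pow_succ_log_self (b := 2) (by norm_num) (deg x)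
      rw [hxt, Nat.succ_eq_add_one, pow_succ] at h
      rw [← hN, pow_add]
      simp only [deg] at h
      omega)
  refine ⟨J, ht.trans ?_⟩
  have hsub : (U.filter fun x => Nat.log 2 (deg x) = t).filter
      (fun x => (J.filter fun i => x ∈ S i).card = 1) ⊆
      U.filter fun x => (J.filter fun i => x ∈ S i).card = 1 :=
    Finset.filter_subset_filter _ (Finset.filter_subset _ _)
  rw [mul_comm 8, mul_assoc]
  exact Nat.mul_le_mul_left _ (hJ.trans (Nat.mul_le_mul_left _ (Finset.card_le_card hsub)))

end UniqueFromCoverage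

/-! ### Coverage of a greedily chosen family -/

/-- With `k` kept sets the gains of `g / (16 k)` sum to `g / 16`. Otherwise every set of `I` outside
`K` was rejected for its small gain, so the sets of `I` miss at most `g / 16` of `O`, which has at
least `g / 8` elements. Rejection is stated relative to the final `K`. -/
theorem le_coverage_of_greedy {S : ℕ → Finset ℕ} {K I O : Finset ℕ} {k g : ℕ} (hk : 1 ≤ k)
    (hK : g * K.card ≤ 16 * k * (K.biUnion S).card)
    (hrej : ∀ i ∈ I, i ∉ K → k ≤ K.card ∨ 16 * k * (S i \ K.biUnion S).card < g)
    (hI : I.card ≤ k) (hO : O ⊆ I.biUnion S) (hOg : g ≤ 8 * O.card) :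
    g ≤ 16 * (K.biUnion S).card := by
  rcases le_or_gt k K.card with hk' | hk'
  · refine Nat.le_of_mul_le_mul_right ?_ hk
    calc g * k ≤ g * K.card := Nat.mul_le_mul_left _ hk'
      _ ≤ 16 * k * (K.biUnion S).card := hK
      _ = _ := by ring
  · have hsub : O \ K.biUnion S ⊆ I.biUnion fun i => S i \ K.biUnion S := by
      intro x hx
      obtain ⟨hxO, hxK⟩ := Finset.mem_sdiff.1 hx
      obtain ⟨i, hi, hxi⟩ := Finset.mem_biUnion.1 (hO hxO)
      exact Finset.mem_biUnion.2 ⟨i, hi, Finset.mem_sdiff.2 ⟨hxi, hxK⟩⟩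
    have hsum : 16 * k * (O \ K.biUnion S).card ≤ k * g := by
      calc 16 * k * (O \ K.biUnion S).card
          ≤ 16 * k * ∑ i ∈ I, (S i \ K.biUnion S).card :=
            Nat.mul_le_mul_left _ ((Finset.card_le_card hsub).trans Finset.card_biUnion_le)
        _ = ∑ i ∈ I, 16 * k * (S i \ K.biUnion S).card := by rw [Finset.mul_sum]
        _ ≤ ∑ _i ∈ I, g := by
            refine Finset.sum_le_sum fun i hi => ?_
            by_cases hiK : i ∈ K
            · have : S i \ K.biUnion S = ∅ :=
                Finset.sdiff_eq_empty_iff_subset.2 (Finset.subset_biUnion_of_mem S hiK)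
              simp [this]
            · exact ((hrej i hi hiK).resolve_left (by omega)).le
        _ ≤ k * g := by
            rw [Finset.sum_const, smul_eq_mul]
            exact Nat.mul_le_mul_right _ hI
    have h1 : 16 * (O \ K.biUnion S).card ≤ g := by
      refine le_of_mul_le_mul_left (a := k) ?_ hk
      linarith
    have h2 : O.card ≤ (O \ K.biUnion S).card + (K.biUnion S).card := by
      have := Finset.le_card_sdiff (K.biUnion S) O
      omega
    omega


/-! ### Records -/

section Records

@[simp]
theorem record_inj {j i x j' i' x' : ℕ} :
    record j i x = record j' i' x' ↔ j = j' ∧ i = i' ∧ x = x' := by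
  simp [record, Nat.pair_eq_pair]

@[simp]
theorem unpair_record_fst (j i x : ℕ) : (record j i x).unpair.1 = j := by simp [record]

@[simp]
theorem unpair_record_snd (j i x : ℕ) : (record j i x).unpair.2 = Nat.pair i x := by simp [record]

theorem sum_toNat (N : ℕ) (b : ℕ → Bool) :
    ∑ i ∈ Finset.range N, (b i).toNat = ((Finset.range N).filter fun i => b i = true).card := by
  rw [Finset.card_filter]
  refine Finset.sum_congr rfl fun i _ => ?_
  cases b i <;> rfl

theorem isKept_iff {n : ℕ} {recs : List ℕ} {j i : ℕ} :
    isKept n recs j i = true ↔ ∃ x < n, record j i x ∈ recs := by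
  unfold isKept
  rw [sum_toNat, decide_eq_true_eq, Finset.card_pos]
  simp [Finset.Nonempty]

theorem filter_range_eq (J j : ℕ) (q : ℕ → Bool) :
    ((List.range J).filter q).filter (fun j' => decide (j' = j))
      = if j < J ∧ q j = true then [j] else [] := by
  induction J with
  | zero => simp
  | succ J ih =>
    rw [List.range_succ, List.filter_append, List.filter_append, ih]
    rcases lt_trichotomy j J with h | rfl | h
    · have h1 : J ≠ j := by omega
      cases hq : q J <;> simp [hq, h, h1, show j < J + 1 by omega]
    · cases hq : q j <;> simp [hq]
    · have h1 : J ≠ j := by omega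
      cases hq : q J <;> simp [hq, h1, show ¬ j < J by omega, show ¬ j < J + 1 by omega]

variable (c : ℕ) (p : ℕ × ℕ × ℕ) (ω : ℕ)

theorem load_readElement (cur : ℕ) (recs : List ℕ) (x j : ℕ) :
    load (readElement c p ω cur recs x) j = load recs j +
      if j < reps c p * lgSize p ∧ sampled c p ω j x = true ∧ load recs j < capacity c p
        then 1 else 0 := by
  have hcomp : ((fun e => decide (e.unpair.1 = j)) ∘ fun j' => record j' cur x)
      = fun j' => decide (j' = j) := by
    funext j'; simp
  have h := filter_range_eq (reps c p * lgSize p) j fun j =>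
    sampled c p ω j x && decide (load recs j < capacity c p)
  unfold readElement
  rw [load, List.filter_append, List.filter_map, List.length_append, List.length_map, hcomp, h]
  simp only [Bool.and_eq_true, decide_eq_true_eq]
  split_ifs <;> simp [load, add_comm]

theorem mem_readElement {cur : ℕ} {recs : List ℕ} {x e : ℕ} :
    e ∈ readElement c p ω cur recs x ↔ e ∈ recs ∨ ∃ j, e = record j cur x ∧
      j < reps c p * lgSize p ∧ sampled c p ω j x = true ∧ load recs j < capacity c p := by
  unfold readElement
  simp only [List.mem_append, List.mem_map, List.mem_filter, List.mem_range, Bool.and_eq_true,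
    decide_eq_true_eq]
  constructor
  · rintro (⟨j, h, rfl⟩ | h)
    · exact Or.inr ⟨j, rfl, h⟩
    · exact Or.inl h
  · rintro (h | ⟨j, rfl, h⟩)
    · exact Or.inr h
    · exact Or.inl ⟨j, h, rfl⟩

theorem load_closeSet_le (cur : ℕ) (recs : List ℕ) (j : ℕ) :
    load (closeSet c p cur recs) j ≤ load recs j := by
  unfold load closeSet
  rw [List.filter_comm]
  exact List.length_filter_le _ _

/-- A full instance loses no records at the end of a set, so it stays full. Hence a final load below
`capacity` certifies that no record was ever refused. -/
theorem load_lt_of_load_closeSet_lt {cur : ℕ} {recs : List ℕ} {j : ℕ}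
    (h : load (closeSet c p cur recs) j < capacity c p) : load recs j < capacity c p := by
  by_contra! hge
  have heq : load (closeSet c p cur recs) j = load recs j := by
    unfold load closeSet
    rw [List.filter_comm]
    congr 1
    refine List.filter_eq_self.2 fun e he => ?_
    have he' : e.unpair.1 = j := by simpa using (List.mem_filter.1 he).2
    simp [survives, he', hge]
  omega

theorem mem_closeSet {cur : ℕ} {recs : List ℕ} {j i x : ℕ} (h : load recs j < capacity c p) :
    record j i x ∈ closeSet c p cur recs ↔
      record j i x ∈ recs ∧ (i ≠ cur ∨ accepts c p cur recs j = true) := by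
  unfold closeSet survives
  rw [List.mem_filter]
  simp [h.not_ge]

end Records

/-! ### Invariants -/

section Invariants

variable (c : ℕ) (p : ℕ × ℕ × ℕ) (ω : ℕ) (𝒮 : ℕ → Finset ℕ)

/-- The elements of the set `i` that instance `j` samples. -/
def samplePart (j i : ℕ) : Finset ℕ := (𝒮 i).filter fun x => sampled c p ω j x = true

/-- The records of instance `j` are the sampled elements of the greedily chosen sets `K` and of
the part `cl` of the current set `cur`. -/
structure IsGreedyState (recs : List ℕ) (j cur : ℕ) (cl K : Finset ℕ) : Prop where
  mem_iff : ∀ i x, record j i x ∈ recs ↔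
    sampled c p ω j x = true ∧ (i ∈ K ∧ x ∈ 𝒮 i ∨ i = cur ∧ x ∈ cl)
  lt_cur : ∀ i ∈ K, i < cur
  card_le : K.card ≤ p.2.2
  goal_le : goal c p (j % lgSize p) * K.card ≤
    16 * p.2.2 * (K.biUnion (samplePart c p ω 𝒮 j)).card
  rejected : ∀ i < cur, i ∉ K → p.2.2 ≤ K.card ∨
    16 * p.2.2 * (samplePart c p ω 𝒮 j i \ K.biUnion (samplePart c p ω 𝒮 j)).card
      < goal c p (j % lgSize p)
  nonempty : ∀ i ∈ K, (samplePart c p ω 𝒮 j i).Nonempty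

/-- The invariant of the algorithm after the part `cl` of the set `cur` has been read. -/
structure IsRunState (cur : ℕ) (cl : Finset ℕ) (recs : List ℕ) : Prop where
  nodup : recs.Nodup
  form : ∀ e ∈ recs, ∃ j i x, e = record j i x ∧ j < reps c p * lgSize p ∧ x < p.1 ∧
    (i < cur ∨ i = cur ∧ x ∈ cl)
  load_le : ∀ j, load recs j ≤ capacity c p
  greedy : ∀ j < reps c p * lgSize p, load recs j < capacity c p →
    ∃ K, IsGreedyState c p ω 𝒮 recs j cur cl K
  load_lt : ∀ j < reps c p * lgSize p,
    (∀ i, (p.2.2 + 1) * (samplePart c p ω 𝒮 j i).card < capacity c p) →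
      load recs j < capacity c p

variable {c p ω 𝒮}

/-- The records belong to the at most `k` sets of `K` and the current set, which together have fewer
than `capacity` sampled elements by `hsmall`. -/
theorem IsGreedyState.load_lt {recs : List ℕ} {j cur : ℕ} {cl K : Finset ℕ}
    (h : IsGreedyState c p ω 𝒮 recs j cur cl K) (hnd : recs.Nodup)
    (hform : ∀ e ∈ recs, ∃ j i x, e = record j i x) (hcl : cl ⊆ 𝒮 cur)
    (hsmall : ∀ i, (p.2.2 + 1) * (samplePart c p ω 𝒮 j i).card < capacity c p) :
    load recs j < capacity c p := by
  have hsub : (recs.filter fun e => decide (e.unpair.1 = j)).toFinset ⊆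
      (insert cur K).biUnion fun i => (samplePart c p ω 𝒮 j i).image (record j i) := by
    intro e he
    rw [List.mem_toFinset, List.mem_filter, decide_eq_true_eq] at he
    obtain ⟨j', i, x, rfl⟩ := hform e he.1
    obtain rfl : j' = j := by simpa using he.2
    obtain ⟨hx, hi⟩ := (h.mem_iff i x).1 he.1
    refine Finset.mem_biUnion.2 ⟨i, ?_, Finset.mem_image.2 ⟨x, ?_, rfl⟩⟩
    · rcases hi with hi | hi
      · exact Finset.mem_insert_of_mem hi.1
      · exact hi.1 ▸ Finset.mem_insert_self _ _
    · rcases hi with hi | hi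
      · exact Finset.mem_filter.2 ⟨hi.2, hx⟩
      · exact Finset.mem_filter.2 ⟨hi.1 ▸ hcl hi.2, hx⟩
  have h1 : load recs j ≤ ∑ i ∈ insert cur K, (samplePart c p ω 𝒮 j i).card := by
    unfold load
    rw [← List.toFinset_card_of_nodup (hnd.filter _)]
    refine (Finset.card_le_card hsub).trans (Finset.card_biUnion_le.trans ?_)
    exact Finset.sum_le_sum fun i _ => Finset.card_image_le
  have h2 : (insert cur K).card ≤ p.2.2 + 1 :=
    (Finset.card_insert_le _ _).trans (by have := h.card_le; omega)
  have h3 : ∑ i ∈ insert cur K, (p.2.2 + 1) * (samplePart c p ω 𝒮 j i).card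
      < ∑ _i ∈ insert cur K, capacity c p :=
    Finset.sum_lt_sum_of_nonempty (Finset.insert_nonempty _ _) fun i _ => hsmall i
  rw [← Finset.mul_sum, Finset.sum_const, smul_eq_mul] at h3
  have h4 := Nat.mul_le_mul_right (capacity c p) h2
  have h5 := Nat.mul_le_mul_left (p.2.2 + 1) h1
  exact lt_of_mul_lt_mul_left (h5.trans_lt (h3.trans_le h4)) (Nat.zero_le _)

theorem isRunState_nil (hk : 1 ≤ p.2.2) : IsRunState c p ω 𝒮 0 ∅ [] := by
  have hcap : 0 < capacity c p := by
    have := rate_ge c hk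
    unfold capacity
    positivity
  refine ⟨List.nodup_nil, by simp, by simp [load], fun j _ _ => ⟨∅, ?_⟩, fun _ _ _ => by simpa [load]⟩
  exact ⟨by simp, by simp, by simp, by simp, by simp, by simp⟩

theorem IsGreedyState.readElement {recs : List ℕ} {j cur x : ℕ} {cl K : Finset ℕ}
    (h : IsGreedyState c p ω 𝒮 recs j cur cl K) (hj : j < reps c p * lgSize p)
    (hload : load recs j < capacity c p) :
    IsGreedyState c p ω 𝒮 (readElement c p ω cur recs x) j cur (insert x cl) K := by
  refine ⟨fun i y => ?_, h.lt_cur, h.card_le, h.goal_le, h.rejected, h.nonempty⟩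
  rw [mem_readElement, h.mem_iff]
  simp only [record_inj, Finset.mem_insert]
  constructor
  · rintro (⟨h1, h2⟩ | ⟨j', ⟨rfl, rfl, rfl⟩, -, h1, -⟩)
    · exact ⟨h1, h2.imp_right fun h => ⟨h.1, Or.inr h.2⟩⟩
    · exact ⟨h1, Or.inr ⟨rfl, Or.inl rfl⟩⟩
  · rintro ⟨h1, h2 | ⟨rfl, rfl | h2⟩⟩
    · exact Or.inl ⟨h1, Or.inl h2⟩
    · exact Or.inr ⟨j, ⟨rfl, rfl, rfl⟩, hj, h1, hload⟩
    · exact Or.inl ⟨h1, Or.inr ⟨rfl, h2⟩⟩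

theorem IsRunState.readElement {cur x : ℕ} {cl : Finset ℕ} {recs : List ℕ}
    (h : IsRunState c p ω 𝒮 cur cl recs) (hx : x ∉ cl) (hxn : x < p.1)
    (hcl : insert x cl ⊆ 𝒮 cur) :
    IsRunState c p ω 𝒮 cur (insert x cl) (readElement c p ω cur recs x) := by
  have hform : ∀ e ∈ UniqueCoverage.readElement c p ω cur recs x,
      ∃ j i y, e = record j i y ∧ j < reps c p * lgSize p ∧ y < p.1 ∧
        (i < cur ∨ i = cur ∧ y ∈ insert x cl) := by
    intro e he
    rcases (mem_readElement c p ω).1 he with he | ⟨j, rfl, hj, -, -⟩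
    · obtain ⟨j, i, y, he, hj, hy, hi⟩ := h.form e he
      exact ⟨j, i, y, he, hj, hy, hi.imp_right fun h => ⟨h.1, Finset.mem_insert_of_mem h.2⟩⟩
    · exact ⟨j, cur, x, rfl, hj, hxn, Or.inr ⟨rfl, Finset.mem_insert_self _ _⟩⟩
  have hnd : (UniqueCoverage.readElement c p ω cur recs x).Nodup := by
    refine List.Nodup.append ((List.nodup_range.filter _).map fun a b hab => by simpa using hab)
      h.nodup ?_
    intro e he he'
    obtain ⟨j, -, rfl⟩ := List.mem_map.1 he
    obtain ⟨j', i, y, heq, -, -, hi⟩ := h.form _ he'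
    obtain ⟨-, rfl, rfl⟩ := record_inj.1 heq
    rcases hi with hi | hi
    · exact lt_irrefl _ hi
    · exact hx hi.2
  refine ⟨hnd, hform, fun j => ?_, fun j hj hl => ?_, fun j hj hs => ?_⟩
  · rw [load_readElement]
    have := h.load_le j
    split_ifs with hif
    · exact hif.2.2
    · exact this
  · have hl' : load recs j < capacity c p := by
      rw [load_readElement] at hl
      omega
    obtain ⟨K, hK⟩ := h.greedy j hj hl'
    exact ⟨K, hK.readElement hj hl'⟩
  -- The instance was not full, so `x` was recorded wherever it is sampled; the new state is again
  -- greedy, and counting its records bounds the load afresh.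
  · obtain ⟨K, hK⟩ := h.greedy j hj (h.load_lt j hj hs)
    refine (hK.readElement (x := x) hj (h.load_lt j hj hs)).load_lt hnd (fun e he => ?_) hcl hs
    obtain ⟨j, i, y, he, -⟩ := hform e he
    exact ⟨j, i, y, he⟩

/-- A kept set is visible only through its records. The count is right because kept sets have
nonempty samples, which acceptance ensures: the goal is positive, hence so is the gain. -/
theorem IsGreedyState.numKept_eq {recs : List ℕ} {j cur : ℕ} {cl K : Finset ℕ}
    (h : IsGreedyState c p ω 𝒮 recs j cur cl K) (h𝒮 : ∀ i, ∀ x ∈ 𝒮 i, x < p.1) :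
    numKept p.1 recs j cur = K.card := by
  unfold numKept
  rw [sum_toNat]
  congr 1
  ext i
  simp only [Finset.mem_filter, Finset.mem_range, isKept_iff]
  constructor
  · rintro ⟨hi, x, -, hx⟩
    rcases ((h.mem_iff i x).1 hx).2 with h1 | h1
    · exact h1.1
    · omega
  · intro hi
    obtain ⟨x, hx⟩ := h.nonempty i hi
    obtain ⟨hx1, hx2⟩ := Finset.mem_filter.1 hx
    exact ⟨h.lt_cur i hi, x, h𝒮 i x hx1, (h.mem_iff i x).2 ⟨hx2, Or.inl ⟨hi, hx1⟩⟩⟩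

theorem IsGreedyState.gain_eq {recs : List ℕ} {j cur : ℕ} {K : Finset ℕ}
    (h : IsGreedyState c p ω 𝒮 recs j cur (𝒮 cur) K) (h𝒮 : ∀ i, ∀ x ∈ 𝒮 i, x < p.1) :
    gain p.1 recs j cur =
      (samplePart c p ω 𝒮 j cur \ K.biUnion (samplePart c p ω 𝒮 j)).card := by
  unfold gain multiplicity
  rw [sum_toNat]
  congr 1
  ext x
  simp only [sum_toNat, Finset.mem_filter, Finset.mem_range, Bool.and_eq_true, decide_eq_true_eq,
    Finset.card_eq_zero, Finset.filter_eq_empty_iff, Finset.mem_sdiff, Finset.mem_biUnion,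
    samplePart, h.mem_iff]
  constructor
  · rintro ⟨-, ⟨hs, hcur⟩, hno⟩
    refine ⟨⟨?_, hs⟩, ?_⟩
    · rcases hcur with hcur | hcur
      · exact hcur.2
      · exact hcur.2
    · rintro ⟨i, hi, hxi, -⟩
      exact hno (h.lt_cur i hi) ⟨hs, Or.inl ⟨hi, hxi⟩⟩
  · rintro ⟨⟨hx, hs⟩, hno⟩
    refine ⟨h𝒮 _ _ hx, ⟨hs, Or.inr ⟨trivial, hx⟩⟩, ?_⟩
    rintro i hi ⟨-, hi' | hi'⟩
    · exact hno ⟨i, hi'.1, hi'.2, hs⟩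
    · omega

theorem goal_pos (hk : 1 ≤ p.2.2) (i : ℕ) : 0 < goal c p i :=
  lt_min (by positivity) (by have := rate_ge c hk; omega)

theorem IsGreedyState.closeSet {recs : List ℕ} {j cur : ℕ} {K : Finset ℕ} (hk : 1 ≤ p.2.2)
    (h : IsGreedyState c p ω 𝒮 recs j cur (𝒮 cur) K) (h𝒮 : ∀ i, ∀ x ∈ 𝒮 i, x < p.1)
    (hload : load recs j < capacity c p) :
    ∃ K', IsGreedyState c p ω 𝒮 (closeSet c p cur recs) j (cur + 1) ∅ K' := by
  have hcur : cur ∉ K := fun hc => lt_irrefl _ (h.lt_cur cur hc)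
  have hacc : accepts c p cur recs j = true ↔ K.card < p.2.2 ∧ goal c p (j % lgSize p) ≤
      16 * p.2.2 * (samplePart c p ω 𝒮 j cur \ K.biUnion (samplePart c p ω 𝒮 j)).card := by
    unfold accepts
    rw [h.numKept_eq h𝒮, h.gain_eq h𝒮, Bool.and_eq_true, decide_eq_true_eq, decide_eq_true_eq,
      mul_comm (16 * p.2.2)]
  by_cases ha : accepts c p cur recs j = true
  · obtain ⟨ha1, ha2⟩ := hacc.1 ha
    have hunion : (insert cur K).biUnion (samplePart c p ω 𝒮 j) =
        samplePart c p ω 𝒮 j cur ∪ K.biUnion (samplePart c p ω 𝒮 j) := Finset.biUnion_insert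
    refine ⟨insert cur K, fun i x => ?_, fun i hi => ?_, ?_, ?_, fun i hi hiK => ?_, fun i hi => ?_⟩
    · rw [mem_closeSet c p hload, h.mem_iff]
      simp only [ha, or_true, and_true, Finset.mem_insert, Finset.notMem_empty, and_false, or_false]
      refine and_congr_right fun _ => ?_
      constructor
      · rintro (h1 | ⟨rfl, h1⟩)
        · exact ⟨Or.inr h1.1, h1.2⟩
        · exact ⟨Or.inl rfl, h1⟩
      · rintro ⟨rfl | h1, h2⟩
        · exact Or.inr ⟨rfl, h2⟩
        · exact Or.inl ⟨h1, h2⟩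
    · rcases Finset.mem_insert.1 hi with rfl | hi
      · omega
      · exact (h.lt_cur i hi).trans (Nat.lt_succ_self _)
    · rw [Finset.card_insert_of_notMem hcur]; omega
    · rw [Finset.card_insert_of_notMem hcur, hunion, ← Finset.card_sdiff_add_card, mul_add, mul_add,
        mul_one]
      have := h.goal_le
      omega
    · rw [Finset.mem_insert, not_or] at hiK
      rcases h.rejected i (by omega) hiK.2 with h1 | h1
      · exact absurd ha1 (by omega)
      -- Gains only shrink as `K` grows, so earlier rejections remain justified.
      · refine Or.inr (lt_of_le_of_lt (Nat.mul_le_mul_left _ (Finset.card_le_card ?_)) h1)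
        rw [hunion]
        exact Finset.sdiff_subset_sdiff (Finset.Subset.refl _) Finset.subset_union_right
    · rcases Finset.mem_insert.1 hi with rfl | hi
      · have hpos : 0 < 16 * p.2.2 *
            (samplePart c p ω 𝒮 j i \ K.biUnion (samplePart c p ω 𝒮 j)).card :=
          (goal_pos hk _).trans_le ha2
        have := Finset.card_pos.1 (Nat.pos_of_mul_pos_left hpos)
        exact this.mono Finset.sdiff_subset
      · exact h.nonempty i hi
  · refine ⟨K, fun i x => ?_, fun i hi => (h.lt_cur i hi).trans (Nat.lt_succ_self _), h.card_le,
      h.goal_le, fun i hi hiK => ?_, h.nonempty⟩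
    · rw [mem_closeSet c p hload, h.mem_iff]
      simp only [ha, Bool.false_eq_true, or_false, Finset.notMem_empty, and_false]
      constructor
      · rintro ⟨⟨h1, h2 | h2⟩, h3⟩
        · exact ⟨h1, h2⟩
        · exact absurd h2.1 h3
      · rintro ⟨h1, h2⟩
        exact ⟨⟨h1, Or.inl h2⟩, (h.lt_cur i h2.1).ne⟩
    · rcases Nat.lt_succ_iff_lt_or_eq.1 hi with hi | rfl
      · exact h.rejected i hi hiK
      · rw [hacc] at ha
        by_contra! hcon
        exact ha ⟨hcon.1, hcon.2⟩

theorem IsRunState.closeSet {cur : ℕ} {recs : List ℕ} (hk : 1 ≤ p.2.2)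
    (h𝒮 : ∀ i, ∀ x ∈ 𝒮 i, x < p.1) (h : IsRunState c p ω 𝒮 cur (𝒮 cur) recs) :
    IsRunState c p ω 𝒮 (cur + 1) ∅ (closeSet c p cur recs) := by
  refine ⟨h.nodup.filter _, fun e he => ?_,
    fun j => (load_closeSet_le c p cur recs j).trans (h.load_le j), fun j hj hl => ?_,
    fun j hj hs => (load_closeSet_le c p cur recs j).trans_lt (h.load_lt j hj hs)⟩
  · obtain ⟨j, i, x, rfl, hj, hx, hi⟩ := h.form e (List.mem_filter.1 he).1
    exact ⟨j, i, x, rfl, hj, hx, Or.inl (by omega)⟩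
  · have hl' := load_lt_of_load_closeSet_lt c p hl
    obtain ⟨K, hK⟩ := h.greedy j hj hl'
    exact hK.closeSet hk h𝒮 hl'

end Invariants

/-! ### Runs of the algorithm -/

section Run

variable {c : ℕ} {p : ℕ × ℕ × ℕ} {ω : ℕ} {𝒮 : ℕ → Finset ℕ}

theorem prefix_append_cases {α : Type*} {v a b : List α} (h : v <+: a ++ b) :
    v <+: a ∨ ∃ v', v = a ++ v' ∧ v' <+: b := by
  obtain ⟨t, ht⟩ := h
  rcases List.append_eq_append_iff.1 ht with ⟨u, hu, -⟩ | ⟨u, hu, hb⟩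
  · exact Or.inl ⟨u, hu.symm⟩
  · exact Or.inr ⟨u, hu, t, hb.symm⟩

/-- The part of the stream that lists a set. -/
def setTokens (l : List ℕ) : List (Option ℕ) := l.map some ++ [none]

theorem exists_isRunState_of_elements {cur : ℕ} (l : List ℕ) :
    ∀ {cl : Finset ℕ} {recs : List ℕ}, IsRunState c p ω 𝒮 cur cl recs → l.Nodup →
      (∀ x ∈ l, x ∉ cl) → (∀ x ∈ 𝒮 cur, x < p.1) → cl ∪ l.toFinset ⊆ 𝒮 cur →
      ∃ recs', (l.map some).foldl (readToken c p) (ω :: cur :: recs) = ω :: cur :: recs' ∧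
        IsRunState c p ω 𝒮 cur (cl ∪ l.toFinset) recs' := by
  induction l with
  | nil => intro cl recs h _ _ _ _; exact ⟨recs, rfl, by simpa using h⟩
  | cons x l ih =>
    intro cl recs h hnd hcl h𝒮 hsub
    rw [List.nodup_cons] at hnd
    rw [List.toFinset_cons, Finset.union_insert, ← Finset.insert_union] at hsub ⊢
    have hx : x ∈ 𝒮 cur := hsub (by simp)
    have h1 := h.readElement (hcl x (by simp)) (h𝒮 x hx)
      ((Finset.subset_union_left).trans hsub)
    refine ih h1 hnd.2 (fun y hy => ?_) h𝒮 hsub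
    rw [Finset.mem_insert, not_or]
    exact ⟨fun h => hnd.1 (h ▸ hy), hcl y (List.mem_cons_of_mem _ hy)⟩

theorem foldl_setTokens (hk : 1 ≤ p.2.2) (h𝒮 : ∀ i, ∀ x ∈ 𝒮 i, x < p.1) {cur : ℕ} {l recs : List ℕ}
    (h : IsRunState c p ω 𝒮 cur ∅ recs) (hnd : l.Nodup) (hl : l.toFinset = 𝒮 cur) :
    ∃ recs', (setTokens l).foldl (readToken c p) (ω :: cur :: recs) = ω :: (cur + 1) :: recs' ∧
      IsRunState c p ω 𝒮 (cur + 1) ∅ recs' := by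
  obtain ⟨recs', h1, h2⟩ := exists_isRunState_of_elements l h hnd (by simp) (h𝒮 cur)
    (by simp [hl])
  rw [Finset.empty_union, hl] at h2
  exact ⟨_, by rw [setTokens, List.foldl_append, h1]; rfl, h2.closeSet hk h𝒮⟩

theorem foldl_prefix_setTokens (hk : 1 ≤ p.2.2) (h𝒮 : ∀ i, ∀ x ∈ 𝒮 i, x < p.1) {cur : ℕ}
    {l recs : List ℕ} (h : IsRunState c p ω 𝒮 cur ∅ recs) (hnd : l.Nodup)
    (hl : l.toFinset = 𝒮 cur) {v : List (Option ℕ)} (hv : v <+: setTokens l) :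
    ∃ cur' cl recs', cur' ≤ cur + 1 ∧
      v.foldl (readToken c p) (ω :: cur :: recs) = ω :: cur' :: recs' ∧
      IsRunState c p ω 𝒮 cur' cl recs' := by
  rcases List.prefix_concat_iff.1 (show v <+: l.map some ++ [none] from hv) with rfl | hv
  · obtain ⟨recs', h1, h2⟩ := foldl_setTokens hk h𝒮 h hnd hl
    exact ⟨_, _, recs', le_rfl, h1, h2⟩
  · obtain ⟨l', hl', rfl⟩ := List.prefix_map_iff.1 hv
    obtain ⟨recs', h1, h2⟩ := exists_isRunState_of_elements l' h (hl'.sublist.nodup hnd) (by simp)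
      (h𝒮 cur) (by
        intro x hx
        rw [← hl]
        exact List.mem_toFinset.2 (hl'.subset (by simpa using hx)))
    exact ⟨_, _, recs', Nat.le_succ _, h1, h2⟩

theorem foldl_stream (hk : 1 ≤ p.2.2) (h𝒮 : ∀ i, ∀ x ∈ 𝒮 i, x < p.1) (Ls : List (List ℕ)) :
    ∀ {cur : ℕ} {recs : List ℕ}, IsRunState c p ω 𝒮 cur ∅ recs → (∀ l ∈ Ls, l.Nodup) →
      (∀ (t : ℕ) (ht : t < Ls.length), Ls[t].toFinset = 𝒮 (cur + t)) →
      ∃ recs', (Ls.flatMap setTokens).foldl (readToken c p) (ω :: cur :: recs)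
          = ω :: (cur + Ls.length) :: recs' ∧
        IsRunState c p ω 𝒮 (cur + Ls.length) ∅ recs' := by
  induction Ls with
  | nil => intro cur recs h _ _; exact ⟨recs, rfl, h⟩
  | cons l Ls ih =>
    intro cur recs h hnd hL
    obtain ⟨recs₁, h1, h2⟩ := foldl_setTokens hk h𝒮 h (hnd l (by simp)) (hL 0 (by simp))
    obtain ⟨recs₂, h3, h4⟩ := ih h2 (fun l hl => hnd l (by simp [hl])) (fun t ht => by
      have := hL (t + 1) (by simpa using ht)
      rw [show cur + 1 + t = cur + (t + 1) by omega, ← this]; rfl)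
    have hlen : cur + (l :: Ls).length = cur + 1 + Ls.length := by simp; omega
    rw [hlen]
    exact ⟨recs₂, by rw [List.flatMap_cons, List.foldl_append, h1, h3], h4⟩

/-- The space bound concerns every moment of the run, hence arbitrary prefixes, including those that
end inside a set. -/
theorem foldl_prefix_stream (hk : 1 ≤ p.2.2) (h𝒮 : ∀ i, ∀ x ∈ 𝒮 i, x < p.1)
    (Ls : List (List ℕ)) {v : List (Option ℕ)} :
    ∀ {cur : ℕ} {recs : List ℕ}, IsRunState c p ω 𝒮 cur ∅ recs → (∀ l ∈ Ls, l.Nodup) →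
      (∀ (t : ℕ) (ht : t < Ls.length), Ls[t].toFinset = 𝒮 (cur + t)) →
      v <+: Ls.flatMap setTokens →
      ∃ cur' cl recs', cur' ≤ cur + Ls.length ∧
        v.foldl (readToken c p) (ω :: cur :: recs) = ω :: cur' :: recs' ∧
        IsRunState c p ω 𝒮 cur' cl recs' := by
  induction Ls generalizing v with
  | nil =>
    intro cur recs h _ _ hv
    obtain rfl : v = [] := by simpa using hv
    exact ⟨cur, ∅, recs, by simp, rfl, h⟩
  | cons l Ls ih =>
    intro cur recs h hnd hL hv
    rw [List.flatMap_cons] at hv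
    have hlen : cur + (l :: Ls).length = cur + 1 + Ls.length := by simp; omega
    rw [hlen]
    rcases prefix_append_cases hv with hv | ⟨v', rfl, hv'⟩
    · obtain ⟨cur', cl, recs', h1, h2, h3⟩ :=
        foldl_prefix_setTokens hk h𝒮 h (hnd l (by simp)) (hL 0 (by simp)) hv
      exact ⟨cur', cl, recs', by omega, h2, h3⟩
    · obtain ⟨recs₁, h1, h2⟩ := foldl_setTokens hk h𝒮 h (hnd l (by simp)) (hL 0 (by simp))
      obtain ⟨cur', cl, recs', h3, h4, h5⟩ := ih h2 (fun l hl => hnd l (by simp [hl]))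
        (fun t ht => by
          have := hL (t + 1) (by simpa using ht)
          rw [show cur + 1 + t = cur + (t + 1) by omega, ← this]; rfl) hv'
      exact ⟨cur', cl, recs', h3, by rw [List.foldl_append, h1, h4], h5⟩

end Run


/-! ### Quality of the answer -/

/-- Each increase of `k` allows one more insertion: an element of `s` or nothing, that is `s.card +
1` choices. -/
theorem card_powerset_filter_card_le {α : Type*} [DecidableEq α] (s : Finset α) (k : ℕ) :
    (s.powerset.filter fun I => I.card ≤ k).card ≤ (s.card + 1) ^ k := by
  induction k with
  | zero =>
    rw [pow_zero, Finset.card_le_one]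
    intro I hI J hJ
    have h1 := (Finset.mem_filter.1 hI).2
    have h2 := (Finset.mem_filter.1 hJ).2
    rw [Finset.card_eq_zero.1 (Nat.le_zero.1 h1), Finset.card_eq_zero.1 (Nat.le_zero.1 h2)]
  | succ k ih =>
    have hsub : (s.powerset.filter fun I => I.card ≤ k + 1) ⊆
        ((s.powerset.filter fun I => I.card ≤ k) ×ˢ Finset.insertNone s).image
          fun q => q.2.elim q.1 fun x => insert x q.1 := by
      intro I hI
      obtain ⟨hIs, hIc⟩ := Finset.mem_filter.1 hI
      rw [Finset.mem_powerset] at hIs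
      rcases Nat.le_succ_iff.1 hIc with h | h
      · refine Finset.mem_image.2 ⟨(I, none), ?_, rfl⟩
        simp [hIs, h]
      · obtain ⟨x, hx⟩ : I.Nonempty := Finset.card_pos.1 (by omega)
        refine Finset.mem_image.2 ⟨(I.erase x, some x), ?_, Finset.insert_erase hx⟩
        have hcard := Finset.card_erase_of_mem hx
        simp only [Finset.mem_product, Finset.mem_filter, Finset.mem_powerset,
          Finset.some_mem_insertNone]
        exact ⟨⟨(Finset.erase_subset _ _).trans hIs, by omega⟩, hIs hx⟩
    refine (Finset.card_le_card hsub).trans (Finset.card_image_le.trans ?_)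
    rw [Finset.card_product, Finset.card_insertNone, pow_succ]
    exact Nat.mul_le_mul_right _ ih

/-- The elements below `n` that lie in exactly one of the sets `𝒮 i`, `i ∈ I`. -/
def natUniquelyCovered (n : ℕ) (𝒮 : ℕ → Finset ℕ) (I : Finset ℕ) : Finset ℕ :=
  (Finset.range n).filter fun x => (I.filter fun i => x ∈ 𝒮 i).card = 1

/-- The sets of elements that are uniquely covered by some `k` sets. -/
def coverageFamily (p : ℕ × ℕ × ℕ) (𝒮 : ℕ → Finset ℕ) : Finset (Finset ℕ) :=
  ((Finset.range p.2.1).powerset.filter fun I => I.card ≤ p.2.2).image (natUniquelyCovered p.1 𝒮)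

/-- The set of indices below `m` named by the binary digits of `b`. -/
def bitSet (m b : ℕ) : Finset ℕ := (Finset.range m).filter fun i => b.testBit i = true

section Quality

variable {c : ℕ} {p : ℕ × ℕ × ℕ} {ω : ℕ} {𝒮 : ℕ → Finset ℕ}

theorem card_coverageFamily_le : (coverageFamily p 𝒮).card ≤ (p.2.1 + 1) ^ p.2.2 := by
  refine Finset.card_image_le.trans ?_
  simpa using card_powerset_filter_card_le (Finset.range p.2.1) p.2.2

theorem lt_of_mem_coverageFamily {U : Finset ℕ} (hU : U ∈ coverageFamily p 𝒮) :
    ∀ x ∈ U, x < p.1 := by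
  obtain ⟨I, -, rfl⟩ := Finset.mem_image.1 hU
  intro x hx
  exact Finset.mem_range.1 (Finset.mem_filter.1 hx).1

theorem filter_sampled_eq (j : ℕ) (U : Finset ℕ) :
    (U.filter fun x => sampled c p ω j x = true) = sampleOf (threshold c p (j % lgSize p))
      (digitCoeffs (fieldSize p) (indep c p) ω (j / lgSize p)) U := by
  unfold sampled sampleOf
  simp only [decide_eq_true_eq, hashValue_eq]

theorem filter_sampled_eq_self (hk : 1 ≤ p.2.2) {j : ℕ}
    (hj : 2 ^ (j % lgSize p + 1) ≤ rate c p) (U : Finset ℕ) :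
    (U.filter fun x => sampled c p ω j x = true) = U := by
  rw [filter_sampled_eq, threshold_eq_fieldSize c hk hj]
  exact Finset.filter_true_of_mem fun x _ => ZMod.val_lt _

/-- This is why scores can be trusted: for a good seed they exceed the true unique coverage, times
`rate`, by at most a factor 4. The alternative in `hX` is the condition tested by `isCandidate`. -/
theorem IsGoodSeed.card_filter_mul_scale_le (hk : 1 ≤ p.2.2) {𝓤 : Finset (Finset ℕ)} {i₀ : ℕ}
    {U₀ : Finset ℕ} (h : IsGoodSeed c p 𝓤 i₀ U₀ ω) {j : ℕ} (hj : j < reps c p * lgSize p)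
    {U : Finset ℕ} (hU : U ∈ 𝓤)
    (hX : 4 * indep c p ≤ (U.filter fun x => sampled c p ω j x = true).card ∨
      2 ^ (j % lgSize p + 1) ≤ rate c p) :
    (U.filter fun x => sampled c p ω j x = true).card * scale c p (j % lgSize p)
      ≤ 4 * (U.card * rate c p) := by
  rcases le_or_gt (2 ^ (j % lgSize p + 1)) (rate c p) with hle | hlt
  · rw [filter_sampled_eq_self hk hle, scale, max_eq_right hle]
    omega
  · have hX' := hX.resolve_right (by omega)
    have hno := h.1 (j / lgSize p) (Nat.div_lt_of_lt_mul (by rwa [mul_comm])) (j % lgSize p)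
      (Nat.mod_lt _ (lgSize_pos p)) hlt U hU
    simp only [overSampling, Finset.mem_filter, Finset.mem_univ, true_and, not_and, not_le,
      ← filter_sampled_eq] at hno
    have h1 := (hno hX').le
    have h2 := threshold_mul_scale_le c p (j % lgSize p)
    refine le_of_mul_le_mul_right ?_ (fieldSize_pos p)
    generalize (U.filter fun x => sampled c p ω j x = true).card = X at *
    calc X * scale c p (j % lgSize p) * fieldSize p
        = X * fieldSize p * scale c p (j % lgSize p) := by ring
      _ ≤ 4 * (U.card * threshold c p (j % lgSize p)) * scale c p (j % lgSize p) := by gcongr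
      _ = 4 * U.card * (threshold c p (j % lgSize p) * scale c p (j % lgSize p)) := by ring
      _ ≤ 4 * U.card * (fieldSize p * rate c p) := by gcongr
      _ = 4 * (U.card * rate c p) * fieldSize p := by ring

theorem natUniquelyCovered_singleton (h𝒮 : ∀ i, ∀ x ∈ 𝒮 i, x < p.1) (i : ℕ) :
    natUniquelyCovered p.1 𝒮 {i} = 𝒮 i := by
  ext x
  simp only [natUniquelyCovered, Finset.mem_filter, Finset.mem_range, Finset.filter_singleton]
  constructor
  · rintro ⟨-, h⟩
    by_contra hx
    simp [hx] at h
  · intro hx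
    exact ⟨h𝒮 i x hx, by simp [hx]⟩

theorem indep_le_rate : indep c p ≤ rate c p := by
  unfold rate
  exact Nat.le_mul_of_pos_left _ (Nat.mul_pos (by norm_num) (lgSize_pos p))

/-- A set is the unique coverage of the family consisting of it alone. So it has fewer elements than
the guess, and it belongs to the family for which oversampling is excluded; four times its expected
sample is below `4 * rate`. -/
theorem IsGoodSeed.card_samplePart_lt (hk : 1 ≤ p.2.2) (h𝒮 : ∀ i, ∀ x ∈ 𝒮 i, x < p.1)
    (h𝒮m : ∀ i, p.2.1 ≤ i → 𝒮 i = ∅) {i₀ : ℕ} {U₀ : Finset ℕ}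
    (h : IsGoodSeed c p (coverageFamily p 𝒮) i₀ U₀ ω) {j : ℕ} (hj : j < reps c p * lgSize p)
    (hz : ∀ I ⊆ Finset.range p.2.1, I.card ≤ p.2.2 →
      (natUniquelyCovered p.1 𝒮 I).card < 2 ^ (j % lgSize p + 1)) (i : ℕ) :
    (p.2.2 + 1) * (samplePart c p ω 𝒮 j i).card < capacity c p := by
  have hμ := rate_ge c hk
  suffices hX : (samplePart c p ω 𝒮 j i).card < 4 * rate c p by
    unfold capacity
    rw [mul_comm (4 * rate c p)]
    exact Nat.mul_lt_mul_of_pos_left hX (Nat.succ_pos _)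
  rcases le_or_gt p.2.1 i with him | him
  · rw [samplePart, h𝒮m i him]
    simp
    omega
  have hmem : 𝒮 i ∈ coverageFamily p 𝒮 := by
    refine Finset.mem_image.2 ⟨{i}, ?_, natUniquelyCovered_singleton h𝒮 i⟩
    simp [him, hk]
  have hlt := hz {i} (by simpa using him) (by simpa using hk)
  rw [natUniquelyCovered_singleton h𝒮] at hlt
  by_contra! hge
  have hle := h.card_filter_mul_scale_le hk hj hmem
    (Or.inl (by
      have := indep_le_rate (c := c) (p := p)
      unfold samplePart at hge
      omega))
  have hZ : (𝒮 i).card < scale c p (j % lgSize p) := hlt.trans_le (le_max_left _ _)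
  have h1 : 4 * rate c p * scale c p (j % lgSize p) ≤ 4 * ((𝒮 i).card * rate c p) :=
    (Nat.mul_le_mul_right _ hge).trans hle
  have h2 : (𝒮 i).card * rate c p < scale c p (j % lgSize p) * rate c p :=
    Nat.mul_lt_mul_of_pos_right hZ (by omega)
  linarith

theorem goal_mul_scale (i : ℕ) : goal c p i * scale c p i = 2 ^ (i + 1) * rate c p :=
  min_mul_max _ _

/-- The 8 is made of three factors 2: the guess exceeds `2 ^ i` by one, rounding of the threshold
costs one, and undersampling costs one. -/
theorem goal_le_of_notMem_underSampling (hk : 1 ≤ p.2.2) {j : ℕ} {U : Finset ℕ}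
    (hU : 2 ^ (j % lgSize p) ≤ U.card)
    (h : digitCoeffs (fieldSize p) (indep c p) ω (j / lgSize p) ∉
      underSampling (fieldSize p) (indep c p) (threshold c p (j % lgSize p)) U) :
    goal c p (j % lgSize p) ≤ 8 * (U.filter fun x => sampled c p ω j x = true).card := by
  simp only [underSampling, Finset.mem_filter, Finset.mem_univ, true_and, not_lt,
    ← filter_sampled_eq] at h
  generalize (U.filter fun x => sampled c p ω j x = true).card = X at *
  have h1 := le_two_mul_threshold_mul_scale c hk (Nat.mod_lt j (lgSize_pos p))
  have h2 := goal_mul_scale (c := c) (p := p) (j % lgSize p)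
  have hZ := scale_pos c p (j % lgSize p)
  generalize j % lgSize p = i at *
  refine le_of_mul_le_mul_right ?_ (Nat.mul_pos hZ (fieldSize_pos p))
  calc goal c p i * (scale c p i * fieldSize p)
      = 2 * 2 ^ i * (fieldSize p * rate c p) := by rw [← mul_assoc, h2, pow_succ]; ring
    _ ≤ 2 * U.card * (2 * (threshold c p i * scale c p i)) := by gcongr
    _ = 4 * (U.card * threshold c p i) * scale c p i := by ring
    _ ≤ 4 * (2 * (X * fieldSize p)) * scale c p i := by gcongr
    _ = 8 * X * (scale c p i * fieldSize p) := by ring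

theorem natUniquelyCovered_subset_biUnion (I : Finset ℕ) (j : ℕ) :
    ((natUniquelyCovered p.1 𝒮 I).filter fun x => sampled c p ω j x = true) ⊆
      I.biUnion (samplePart c p ω 𝒮 j) := by
  intro x hx
  obtain ⟨hx1, hx2⟩ := Finset.mem_filter.1 hx
  have h := (Finset.mem_filter.1 hx1).2
  obtain ⟨i, hi⟩ := Finset.card_pos.1 (by rw [h]; exact one_pos)
  obtain ⟨hi1, hi2⟩ := Finset.mem_filter.1 hi
  exact Finset.mem_biUnion.2 ⟨i, hi1, Finset.mem_filter.2 ⟨hi2, hx2⟩⟩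

/-- The degree bound `min k r` enters here: an element lies in at most `k` kept sets, and in at most
`r` sets altogether. -/
theorem exists_subset_sampled_coverage (h𝒮 : ∀ i, ∀ x ∈ 𝒮 i, x < p.1) {K : Finset ℕ}
    (hKm : ∀ i ∈ K, i < p.2.1) {k r : ℕ} (hKk : K.card ≤ k)
    (hr : ∀ x, ((Finset.range p.2.1).filter fun i => x ∈ 𝒮 i).card ≤ r) (j : ℕ) :
    ∃ J ⊆ K, (K.biUnion (samplePart c p ω 𝒮 j)).card ≤ 8 * (1 + Nat.log 2 (min k r)) *
      ((natUniquelyCovered p.1 𝒮 J).filter fun x => sampled c p ω j x = true).card := by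
  classical
  have hcount : ∀ (x : ℕ) (A : Finset K), (A.filter fun i : K => x ∈ samplePart c p ω 𝒮 j i).card
      = ((A.map (Function.Embedding.subtype _)).filter fun i => x ∈ samplePart c p ω 𝒮 j i).card := by
    intro x A
    rw [Finset.filter_map, Finset.card_map]
    rfl
  obtain ⟨J, hJ⟩ := exists_subfamily_uniquely_covering
    (S := fun i : K => samplePart c p ω 𝒮 j i) (d := min k r) (fun x => by
      rw [hcount]
      refine le_min ?_ ?_
      · refine (Finset.card_filter_le _ _).trans ?_
        rw [Finset.card_map, Finset.card_univ, Fintype.card_coe]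
        exact hKk
      · refine (Finset.card_le_card fun i hi => ?_).trans (hr x)
        obtain ⟨hi1, hi2⟩ := Finset.mem_filter.1 hi
        obtain ⟨i', -, rfl⟩ := Finset.mem_map.1 hi1
        exact Finset.mem_filter.2 ⟨Finset.mem_range.2 (hKm _ i'.2), (Finset.mem_filter.1 hi2).1⟩)
  have hU : (Finset.univ : Finset K).biUnion (fun i => samplePart c p ω 𝒮 j i)
      = K.biUnion (samplePart c p ω 𝒮 j) := by
    ext x
    simp
  rw [hU] at hJ
  refine ⟨J.map (Function.Embedding.subtype _), fun i hi => ?_, hJ.trans ?_⟩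
  · obtain ⟨i', -, rfl⟩ := Finset.mem_map.1 hi
    exact i'.2
  refine Nat.mul_le_mul_left _ (Finset.card_le_card fun x hx => ?_)
  obtain ⟨hx1, hx2⟩ := Finset.mem_filter.1 hx
  obtain ⟨i, -, hxi⟩ := Finset.mem_biUnion.1 hx1
  obtain ⟨hxi1, hxi2⟩ := Finset.mem_filter.1 hxi
  rw [hcount] at hx2
  refine Finset.mem_filter.2 ⟨Finset.mem_filter.2 ⟨Finset.mem_range.2 (h𝒮 i x hxi1), ?_⟩, hxi2⟩
  rw [← hx2]
  congr 1
  ext i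
  simp [samplePart, hxi2]

theorem exists_bitSet_eq {m : ℕ} {J : Finset ℕ} (hJ : ∀ i ∈ J, i < m) :
    ∃ b < 2 ^ m, bitSet m b = J := by
  refine ⟨Nat.ofBits fun i : Fin m => decide ((i : ℕ) ∈ J), Nat.ofBits_lt_two_pow _, ?_⟩
  ext i
  simp only [bitSet, Finset.mem_filter, Finset.mem_range]
  constructor
  · rintro ⟨hi, h⟩
    rw [Nat.testBit_ofBits_lt _ _ hi] at h
    simpa using h
  · intro hi
    refine ⟨hJ i hi, ?_⟩
    rw [Nat.testBit_ofBits_lt _ _ (hJ i hi)]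
    simpa using hi

theorem IsGreedyState.sampleCoverage_eq {recs : List ℕ} {j b : ℕ} {K : Finset ℕ}
    (h : IsGreedyState c p ω 𝒮 recs j p.2.1 ∅ K) (hb : bitSet p.2.1 b ⊆ K) :
    sampleCoverage p recs j b = ((natUniquelyCovered p.1 𝒮 (bitSet p.2.1 b)).filter
      fun x => sampled c p ω j x = true).card := by
  unfold sampleCoverage
  rw [sum_toNat]
  congr 1
  ext x
  simp only [sum_toNat, natUniquelyCovered, Finset.mem_filter, decide_eq_true_eq, and_assoc]
  refine and_congr_right fun _ => ?_
  by_cases hx : sampled c p ω j x = true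
  · simp only [hx, and_true]
    have : ((Finset.range p.2.1).filter fun i =>
        (b.testBit i && decide (record j i x ∈ recs)) = true)
        = (bitSet p.2.1 b).filter fun i => x ∈ 𝒮 i := by
      ext i
      simp only [bitSet, Finset.mem_filter, Bool.and_eq_true, decide_eq_true_eq, and_assoc,
        h.mem_iff, hx, true_and, Finset.notMem_empty, and_false, or_false]
      refine and_congr_right fun hi => and_congr_right fun hbi => ?_
      exact ⟨fun h => h.2, fun h => ⟨hb (Finset.mem_filter.2 ⟨hi, hbi⟩), h⟩⟩
    rw [this]
  · simp only [hx]
    have : ((Finset.range p.2.1).filter fun i =>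
        (b.testBit i && decide (record j i x ∈ recs)) = true) = ∅ := by
      refine Finset.filter_false_of_mem fun i _ => ?_
      simp [h.mem_iff, hx]
    rw [this]
    simp

theorem isCandidate_iff {recs : List ℕ} {j b : ℕ} :
    isCandidate c p recs j b = true ↔ load recs j < capacity c p ∧
      (∀ i ∈ bitSet p.2.1 b, isKept p.1 recs j i = true) ∧
      (4 * indep c p ≤ sampleCoverage p recs j b ∨ 2 ^ (j % lgSize p + 1) ≤ rate c p) := by
  unfold isCandidate
  rw [sum_toNat]
  simp only [Bool.and_eq_true, Bool.or_eq_true, decide_eq_true_eq, and_assoc,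
    Finset.card_eq_zero, Finset.filter_eq_empty_iff, bitSet, Finset.mem_filter]
  refine and_congr_right fun _ => and_congr_left fun _ => forall_congr' fun i => ?_
  cases isKept p.1 recs j i <;> simp

theorem IsGreedyState.isKept_iff_mem (h𝒮 : ∀ i, ∀ x ∈ 𝒮 i, x < p.1) {recs : List ℕ}
    {j cur i : ℕ} {K : Finset ℕ} (h : IsGreedyState c p ω 𝒮 recs j cur ∅ K) :
    isKept p.1 recs j i = true ↔ i ∈ K := by
  rw [isKept_iff]
  constructor
  · rintro ⟨x, -, hx⟩
    simpa using ((h.mem_iff i x).1 hx).2.imp_left And.left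
  · intro hi
    obtain ⟨x, hx⟩ := h.nonempty i hi
    obtain ⟨hx1, hx2⟩ := Finset.mem_filter.1 hx
    exact ⟨x, h𝒮 i x hx1, (h.mem_iff i x).2 ⟨hx2, Or.inl ⟨hi, hx1⟩⟩⟩

theorem numChoices_pos : 0 < numChoices c p := by
  have := lgSize_pos p
  unfold numChoices reps
  positivity

theorem bestChoice_div_lt (recs : List ℕ) :
    bestChoice c p recs % numChoices c p / 2 ^ p.2.1 < reps c p * lgSize p := by
  have h := Nat.mod_lt (bestChoice c p recs) (numChoices_pos (c := c) (p := p))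
  exact Nat.div_lt_of_lt_mul (by rw [mul_comm]; exact h)

theorem sampleCoverage_le (recs : List ℕ) (j b : ℕ) : sampleCoverage p recs j b ≤ p.1 := by
  unfold sampleCoverage
  rw [sum_toNat]
  exact (Finset.card_filter_le _ _).trans (by simp)

theorem score_le (recs : List ℕ) (j b : ℕ) : score c p recs j b ≤ scoreBound c p := by
  unfold score scoreBound
  refine Nat.mul_le_mul (sampleCoverage_le recs j b) (max_le ?_ (Nat.le_add_left _ _))
  have h : j % lgSize p + 1 ≤ lgSize p := Nat.mod_lt _ (lgSize_pos p)
  exact (Nat.pow_le_pow_right (by norm_num) h).trans (Nat.le_add_right _ _)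

/-- A triple of score `s`, instance `j` and bit pattern `b` is coded as `s * numChoices + j * 2 ^ m
+ b`. The score is the leading digit, so the greatest admissible code has the greatest score; `s` is
only required to be at most the actual score. -/
theorem bestChoice_spec {recs : List ℕ} {j b : ℕ} (hj : j < reps c p * lgSize p)
    (hb : b < 2 ^ p.2.1) (h : isCandidate c p recs j b = true) :
    isCandidate c p recs (bestChoice c p recs % numChoices c p / 2 ^ p.2.1)
        (bestChoice c p recs % numChoices c p % 2 ^ p.2.1) = true ∧
      score c p recs j b ≤ score c p recs (bestChoice c p recs % numChoices c p / 2 ^ p.2.1)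
        (bestChoice c p recs % numChoices c p % 2 ^ p.2.1) := by
  have hq : j * 2 ^ p.2.1 + b < numChoices c p := by
    unfold numChoices
    calc j * 2 ^ p.2.1 + b < (j + 1) * 2 ^ p.2.1 := by rw [add_mul, one_mul]; omega
      _ ≤ _ := Nat.mul_le_mul_right _ hj
  set v := score c p recs j b * numChoices c p + (j * 2 ^ p.2.1 + b) with hv
  have hQ := numChoices_pos (c := c) (p := p)
  have hvdiv : v / numChoices c p = score c p recs j b := by
    rw [hv, mul_comm, Nat.mul_add_div hQ, Nat.div_eq_of_lt hq, add_zero]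
  have hvmod : v % numChoices c p = j * 2 ^ p.2.1 + b := by
    rw [hv, mul_comm, Nat.mul_add_mod, Nat.mod_eq_of_lt hq]
  have h2m : 0 < 2 ^ p.2.1 := by positivity
  have hvj : v % numChoices c p / 2 ^ p.2.1 = j := by
    rw [hvmod, mul_comm, Nat.mul_add_div h2m, Nat.div_eq_of_lt hb, add_zero]
  have hvb : v % numChoices c p % 2 ^ p.2.1 = b := by
    rw [hvmod, mul_comm, Nat.mul_add_mod, Nat.mod_eq_of_lt hb]
  have hle : v ≤ (scoreBound c p + 1) * numChoices c p := by
    rw [add_mul, one_mul]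
    exact Nat.add_le_add (Nat.mul_le_mul_right _ (score_le recs j b)) hq.le
  have hpred : (isCandidate c p recs (v % numChoices c p / 2 ^ p.2.1)
      (v % numChoices c p % 2 ^ p.2.1) && decide (v / numChoices c p ≤
        score c p recs (v % numChoices c p / 2 ^ p.2.1) (v % numChoices c p % 2 ^ p.2.1)))
      = true := by
    rw [hvj, hvb, hvdiv, h]
    simp
  have h1 : (isCandidate c p recs (bestChoice c p recs % numChoices c p / 2 ^ p.2.1)
      (bestChoice c p recs % numChoices c p % 2 ^ p.2.1) &&
        decide (bestChoice c p recs / numChoices c p ≤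
          score c p recs (bestChoice c p recs % numChoices c p / 2 ^ p.2.1)
            (bestChoice c p recs % numChoices c p % 2 ^ p.2.1))) = true :=
    Nat.findGreatest_spec (P := fun v => (isCandidate c p recs
      (v % numChoices c p / 2 ^ p.2.1) (v % numChoices c p % 2 ^ p.2.1) &&
        decide (v / numChoices c p ≤ score c p recs (v % numChoices c p / 2 ^ p.2.1)
          (v % numChoices c p % 2 ^ p.2.1))) = true) hle hpred
  have h2 := Nat.le_findGreatest (P := fun v => (isCandidate c p recs
      (v % numChoices c p / 2 ^ p.2.1) (v % numChoices c p % 2 ^ p.2.1) &&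
        decide (v / numChoices c p ≤ score c p recs (v % numChoices c p / 2 ^ p.2.1)
          (v % numChoices c p % 2 ^ p.2.1))) = true) hle hpred
  change v ≤ bestChoice c p recs at h2
  simp only [Bool.and_eq_true, decide_eq_true_eq] at h1
  refine ⟨h1.1, le_trans ?_ h1.2⟩
  rw [← hvdiv]
  exact Nat.div_le_div_right h2

theorem bestChoice_eq_zero_or (recs : List ℕ) : bestChoice c p recs = 0 ∨
    isCandidate c p recs (bestChoice c p recs % numChoices c p / 2 ^ p.2.1)
        (bestChoice c p recs % numChoices c p % 2 ^ p.2.1) = true := by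
  by_cases h0 : bestChoice c p recs = 0
  · exact Or.inl h0
  · have h1 := Nat.findGreatest_of_ne_zero (m := bestChoice c p recs) rfl h0
    simp only [Bool.and_eq_true, decide_eq_true_eq] at h1
    exact Or.inr h1.1

theorem toFinset_answer (recs : List ℕ) : (answer c p recs).toFinset
    = bitSet p.2.1 (bestChoice c p recs % numChoices c p % 2 ^ p.2.1) := by
  ext i
  simp [answer, bitSet]

theorem IsRunState.exists_greedyState_of_isCandidate (h𝒮 : ∀ i, ∀ x ∈ 𝒮 i, x < p.1)
    {recs : List ℕ} (h : IsRunState c p ω 𝒮 p.2.1 ∅ recs) {j b : ℕ}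
    (hj : j < reps c p * lgSize p) (hb : isCandidate c p recs j b = true) :
    ∃ K, IsGreedyState c p ω 𝒮 recs j p.2.1 ∅ K ∧ bitSet p.2.1 b ⊆ K := by
  obtain ⟨hb1, hb2, -⟩ := isCandidate_iff.1 hb
  obtain ⟨K, hK⟩ := h.greedy j hj hb1
  exact ⟨K, hK, fun i hi => (hK.isKept_iff_mem h𝒮).1 (hb2 i hi)⟩

/-- No good seed is needed. A nonzero best choice names kept sets of one greedy instance, and the
default 0 of the search names the empty family. -/
theorem IsRunState.card_answer_le (h𝒮 : ∀ i, ∀ x ∈ 𝒮 i, x < p.1) {recs : List ℕ}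
    (h : IsRunState c p ω 𝒮 p.2.1 ∅ recs) : (answer c p recs).toFinset.card ≤ p.2.2 := by
  rw [toFinset_answer]
  rcases bestChoice_eq_zero_or (c := c) (p := p) recs with h0 | h0
  · simp [h0, bitSet]
  · obtain ⟨K, hK, hsub⟩ := h.exists_greedyState_of_isCandidate h𝒮 (bestChoice_div_lt recs) h0
    exact (Finset.card_le_card hsub).trans hK.card_le

theorem IsRunState.le_card_answer (hk : 1 ≤ p.2.2) (hkm : p.2.2 ≤ p.2.1)
    (h𝒮 : ∀ i, ∀ x ∈ 𝒮 i, x < p.1)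
    (h𝒮m : ∀ i, p.2.1 ≤ i → 𝒮 i = ∅) {r : ℕ}
    (hr : ∀ x, ((Finset.range p.2.1).filter fun i => x ∈ 𝒮 i).card ≤ r) {recs : List ℕ}
    (h : IsRunState c p ω 𝒮 p.2.1 ∅ recs) {I₀ : Finset ℕ} (hI₀k : I₀.card ≤ p.2.2)
    (hI₀m : ∀ i ∈ I₀, i < p.2.1)
    (hopt : ∀ I ⊆ Finset.range p.2.1, I.card ≤ p.2.2 →
      (natUniquelyCovered p.1 𝒮 I).card ≤ (natUniquelyCovered p.1 𝒮 I₀).card)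
    {i₀ : ℕ} (hi₀ : i₀ < lgSize p) (hlow : 2 ^ i₀ ≤ (natUniquelyCovered p.1 𝒮 I₀).card)
    (hupp : (natUniquelyCovered p.1 𝒮 I₀).card < 2 ^ (i₀ + 1))
    (hgood : IsGoodSeed c p (coverageFamily p 𝒮) i₀ (natUniquelyCovered p.1 𝒮 I₀) ω) :
    (natUniquelyCovered p.1 𝒮 I₀).card ≤ 512 * (1 + Nat.log 2 (min p.2.2 r)) *
      (natUniquelyCovered p.1 𝒮 (answer c p recs).toFinset).card := by
  obtain ⟨ρ, hρ, hunder⟩ := hgood.2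
  have hLpos := lgSize_pos p
  -- The instance to rely on: the hash function that does not undersample the optimal coverage, at
  -- the level whose guess is right.
  obtain ⟨j, hj, hjdiv, hjmod⟩ : ∃ j < reps c p * lgSize p, j / lgSize p = ρ ∧
      j % lgSize p = i₀ := by
    refine ⟨lgSize p * ρ + i₀, ?_, ?_, ?_⟩
    · calc lgSize p * ρ + i₀ < lgSize p * (ρ + 1) := by rw [mul_add, mul_one]; omega
        _ ≤ lgSize p * reps c p := Nat.mul_le_mul_left _ hρ
        _ = _ := mul_comm _ _
    · rw [Nat.mul_add_div hLpos, Nat.div_eq_of_lt hi₀, add_zero]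
    · rw [Nat.mul_add_mod, Nat.mod_eq_of_lt hi₀]
  have hload : load recs j < capacity c p := h.load_lt j hj
    (hgood.card_samplePart_lt hk h𝒮 h𝒮m hj fun I hI hIk => by
      rw [hjmod]; exact (hopt I hI hIk).trans_lt hupp)
  obtain ⟨K, hK⟩ := h.greedy j hj hload
  rw [← hjdiv, ← hjmod] at hunder
  rw [← hjmod] at hlow hupp
  have hO := goal_le_of_notMem_underSampling hk hlow hunder
  have hcov := le_coverage_of_greedy hk hK.goal_le (I := I₀)
    (fun i hi hiK => hK.rejected i (hI₀m i hi) hiK) hI₀k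
    (natUniquelyCovered_subset_biUnion I₀ j) hO
  obtain ⟨J, hJK, hJ⟩ := exists_subset_sampled_coverage (c := c) (ω := ω) h𝒮 hK.lt_cur
    hK.card_le hr j
  obtain ⟨b, hb, rfl⟩ := exists_bitSet_eq fun i hi => hK.lt_cur i (hJK hi)
  rw [← hK.sampleCoverage_eq hJK] at hJ
  set l := 1 + Nat.log 2 (min p.2.2 r) with hl
  have hlL : l ≤ lgSize p := by
    have h1 : Nat.log 2 (min p.2.2 r) ≤ Nat.log 2 p.2.2 := Nat.log_mono_right (min_le_left _ _)
    have h2 : Nat.log 2 p.2.2 < lgSize p := by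
      refine Nat.log_lt_of_lt_pow (by omega) ?_
      have := lt_two_pow_lgSize p
      omega
    omega
  have hgX : goal c p (j % lgSize p) ≤ 128 * l * sampleCoverage p recs j b := by
    have := hcov.trans (Nat.mul_le_mul_left 16 hJ)
    linarith
  have hcand : isCandidate c p recs j b = true := by
    refine isCandidate_iff.2 ⟨hload, fun i hi => (hK.isKept_iff_mem h𝒮).2 (hJK hi), ?_⟩
    rcases le_or_gt (2 ^ (j % lgSize p + 1)) (rate c p) with hle | hlt
    · exact Or.inr hle
    · refine Or.inl ?_
      -- The factor `512 * lgSize p` in `rate` is `4 * (128 * lgSize p)`: after the loss of at most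
      -- `128 * l` with `l ≤ lgSize p`, the sample coverage still reaches the `4 * indep` required
      -- of a candidate.
      have hg : goal c p (j % lgSize p) = 512 * lgSize p * indep c p := min_eq_right hlt.le
      rw [hg] at hgX
      have h1 : 128 * l * sampleCoverage p recs j b ≤
        128 * lgSize p * sampleCoverage p recs j b := by gcongr
      refine le_of_mul_le_mul_left (a := 128 * lgSize p) ?_ (by positivity)
      linarith
  obtain ⟨hbest, hscore⟩ := bestChoice_spec hj hb hcand
  have hj' := bestChoice_div_lt (c := c) (p := p) recs
  rw [toFinset_answer]
  generalize bestChoice c p recs % numChoices c p / 2 ^ p.2.1 = j' at *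
  generalize bestChoice c p recs % numChoices c p % 2 ^ p.2.1 = b' at *
  obtain ⟨K', hK', hsub⟩ := h.exists_greedyState_of_isCandidate h𝒮 hj' hbest
  have hmem : natUniquelyCovered p.1 𝒮 (bitSet p.2.1 b') ∈ coverageFamily p 𝒮 := by
    refine Finset.mem_image_of_mem _ (Finset.mem_filter.2 ⟨?_, ?_⟩)
    · exact Finset.mem_powerset.2 (Finset.filter_subset _ _)
    · exact (Finset.card_le_card hsub).trans hK'.card_le
  have hfin := hgood.card_filter_mul_scale_le hk hj' hmem (by
    rw [← hK'.sampleCoverage_eq hsub]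
    exact (isCandidate_iff.1 hbest).2.2)
  rw [← hK'.sampleCoverage_eq hsub] at hfin
  have hμ := rate_ge c hk
  refine le_of_mul_le_mul_right ?_ (show 0 < rate c p by omega)
  -- The constant: 16 from the greedy choice, 8 from unique coverage, and 4 from overestimation of
  -- the winner, whose instance `j'` need not be `j`.
  calc (natUniquelyCovered p.1 𝒮 I₀).card * rate c p
      ≤ 2 ^ (j % lgSize p + 1) * rate c p := by gcongr
    _ = goal c p (j % lgSize p) * scale c p (j % lgSize p) := (goal_mul_scale _).symm
    _ ≤ 128 * l * sampleCoverage p recs j b * scale c p (j % lgSize p) := by gcongr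
    _ = 128 * l * score c p recs j b := by rw [score]; ring
    _ ≤ 128 * l * score c p recs j' b' := by gcongr
    _ ≤ 128 * l * (4 * ((natUniquelyCovered p.1 𝒮 (bitSet p.2.1 b')).card * rate c p)) := by
        gcongr; exact hfin
    _ = _ := by ring

end Quality


/-! ### The law of the answer -/

theorem toOuterMeasure_coinLaw_le {C N : ℕ} {B : Set ℕ} {G : Finset ℕ}
    (hB : ∀ ω < 2 ^ C, ω ∈ B → ω ∈ G) (hG : G.card * N ≤ 2 ^ C) (hN : N ≠ 0) :
    (coinLaw C).toOuterMeasure B ≤ (N : ℝ≥0∞)⁻¹ := by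
  classical
  rw [coinLaw, PMF.toOuterMeasure_map_apply, PMF.toOuterMeasure_uniformOfFintype_apply]
  have hcard : Fintype.card (Fin.val ⁻¹' B : Set (Fin (2 ^ C))) ≤ G.card := by
    rw [← Fintype.card_coe G]
    refine Fintype.card_le_of_injective
      (fun ω : (Fin.val ⁻¹' B : Set (Fin (2 ^ C))) => (⟨ω.1.1, hB _ ω.1.2 ω.2⟩ : G)) ?_
    intro a b hab
    exact Subtype.ext (Fin.ext (congrArg Subtype.val hab))
  rw [Fintype.card_fin, ← one_div]
  refine ENNReal.div_le_of_le_mul ?_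
  rw [mul_comm, mul_one_div, ENNReal.le_div_iff_mul_le (Or.inl (by exact_mod_cast hN))
    (Or.inl (ENNReal.natCast_ne_top N))]
  exact_mod_cast (Nat.mul_le_mul_right N hcard).trans hG

/-- The algorithm ignores the coins tossed after the start, so its memory law is the image of the
seed law under a deterministic run. -/
theorem foldl_bind_const {σ τ γ : Type*} (f : σ → τ → σ) (ν : PMF γ) (κ : PMF ℕ) (w : List τ) :
    ∀ F : γ → σ, w.foldl (fun μ t => μ.bind fun M => κ.map fun _ => f M t) (ν.map F)
      = ν.map fun a => w.foldl f (F a) := by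
  induction w with
  | nil => intro F; rfl
  | cons t w ih =>
    intro F
    have h : ((ν.map F).bind fun M => κ.map fun _ => f M t) = ν.map fun a => f (F a) t := by
      have hc : ∀ M, (κ.map fun _ => f M t) = PMF.pure (f M t) := fun M => PMF.map_const κ _
      simp only [hc]
      rw [PMF.bind_map]
      rfl
    rw [List.foldl_cons, h, ih]
    rfl

theorem streamAlg_law (c : ℕ) (p : ℕ × ℕ × ℕ) (w : List (Option ℕ)) :
    (streamAlg c).law p w = (coinLaw ((streamAlg c).coins p)).map
      fun ω => w.foldl (readToken c p) [ω, 0] :=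
  foldl_bind_const (readToken c p) _ _ w _

theorem lt_two_pow_of_mem_support_coinLaw {C ω : ℕ} (h : ω ∈ (coinLaw C).support) :
    ω < 2 ^ C := by
  obtain ⟨a, -, rfl⟩ := (PMF.mem_support_map_iff _ _ _).1 h
  exact a.2

/-! ### Space -/

section Space

variable {c : ℕ} {p : ℕ × ℕ × ℕ} {ω : ℕ} {𝒮 : ℕ → Finset ℕ}

theorem size_record_le {j i x : ℕ} (hj : j < reps c p * lgSize p) (hi : i ≤ p.2.1)
    (hx : x < p.1) : (record j i x).size ≤ (2 * c + 10) * lgSize p := by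
  rw [Nat.size_le]
  have hN := lt_two_pow_lgSize p
  have hLpos := lgSize_pos p
  unfold reps at hj
  generalize lgSize p = L at *
  have hL : L ≤ 2 ^ L := Nat.lt_two_pow_self.le
  have hc : c + 3 ≤ 2 ^ (c + 3) := Nat.lt_two_pow_self.le
  have h1 : Nat.pair i x < 2 ^ (2 * L) := by
    refine (Nat.pair_lt_max_add_one_sq i x).trans_le ?_
    rw [mul_comm, pow_mul]
    refine Nat.pow_le_pow_left ?_ 2
    have : max i x ≤ p.2.1 + p.1 := max_le (by omega) (by omega)
    omega
  have h2 : j < 2 ^ ((c + 5) * L) := by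
    refine hj.trans_le ?_
    calc (c + 3) * L * L ≤ 2 ^ (c + 3) * 2 ^ L * 2 ^ L := by gcongr
      _ = 2 ^ (c + 3 + L + L) := by simp only [pow_add]
      _ ≤ 2 ^ ((c + 5) * L) := Nat.pow_le_pow_right (by norm_num) (by nlinarith)
  have h3 : Nat.pair i x < 2 ^ ((c + 5) * L) :=
    h1.trans_le (Nat.pow_le_pow_right (by norm_num) (by nlinarith))
  refine (Nat.pair_lt_max_add_one_sq j _).trans_le ?_
  rw [show (2 * c + 10) * L = (c + 5) * L * 2 by ring, pow_mul]
  exact Nat.pow_le_pow_left (max_lt h2 h3) 2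

theorem IsRunState.length_le {cur : ℕ} {cl : Finset ℕ} {recs : List ℕ}
    (h : IsRunState c p ω 𝒮 cur cl recs) :
    recs.length ≤ reps c p * lgSize p * capacity c p := by
  rw [← List.toFinset_card_of_nodup h.nodup, Finset.card_eq_sum_card_fiberwise
    (f := fun e : ℕ => e.unpair.1) (t := Finset.range (reps c p * lgSize p))]
  · refine (Finset.sum_le_card_nsmul _ _ (capacity c p) fun j _ => ?_).trans
      (by rw [Finset.card_range, smul_eq_mul])
    refine le_trans ?_ (h.load_le j)
    refine le_trans (Finset.card_le_card fun e he => ?_) (List.toFinset_card_le _)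
    obtain ⟨he1, he2⟩ := Finset.mem_filter.1 he
    exact List.mem_toFinset.2 (List.mem_filter.2 ⟨List.mem_toFinset.1 he1, by simpa using he2⟩)
  · intro e he
    obtain ⟨j, i, x, rfl, hj, -⟩ := h.form e (by simpa using he)
    simpa using hj

/-- The leading constant of the space bound. -/
def spaceConst (c : ℕ) : ℕ :=
  2 * (c + 3) * (2 * c + 10) + 3 + 4096 * (c + 3) * (2 * c + 10) * (2 * c + 11)

theorem IsRunState.memSize_le {cur : ℕ} {cl : Finset ℕ} {recs : List ℕ}
    (h : IsRunState c p ω 𝒮 cur cl recs) (hcur : cur ≤ p.2.1)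
    (hω : ω < 2 ^ (streamAlg c).coins p) :
    memSize (ω :: cur :: recs) ≤ (streamAlg c).coins p + lgSize p + 2 +
      reps c p * lgSize p * capacity c p * ((2 * c + 10) * lgSize p + 1) := by
  have h1 : ω.size ≤ (streamAlg c).coins p := Nat.size_le.2 hω
  have h2 : cur.size ≤ lgSize p := Nat.size_le.2 (by have := lt_two_pow_lgSize p; omega)
  have h3 : (recs.map fun w => Nat.size w + 1).sum ≤
      recs.length * ((2 * c + 10) * lgSize p + 1) := by
    have := List.sum_le_card_nsmul (recs.map fun w => Nat.size w + 1)
      ((2 * c + 10) * lgSize p + 1) (by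
        intro y hy
        obtain ⟨e, he, rfl⟩ := List.mem_map.1 hy
        obtain ⟨j, i, x, rfl, hj, hx, hi⟩ := h.form e he
        exact Nat.succ_le_succ (size_record_le hj (by omega) hx))
    simpa using this
  have h4 := Nat.mul_le_mul_right ((2 * c + 10) * lgSize p + 1) h.length_le
  simp only [memSize, List.map_cons, List.sum_cons] at h3 ⊢
  omega

/-- One factor `k` comes from `indep`, one from the `k + 1` sets in `capacity`. The five logarithms
come from `reps`, the number of levels, `rate` (two) and the length of a record. -/
theorem space_le (hk : 1 ≤ p.2.2) : (streamAlg c).coins p + lgSize p + 2 +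
      reps c p * lgSize p * capacity c p * ((2 * c + 10) * lgSize p + 1)
      ≤ spaceConst c * p.2.2 ^ 2 * lgSize p ^ 5 := by
  have hL : 1 ≤ lgSize p := lgSize_pos p
  change (lgSize p + 1) * (reps c p * indep c p) + lgSize p + 2 + _ ≤ _
  unfold capacity rate reps indep spaceConst
  generalize lgSize p = L at *
  generalize p.2.2 = k at *
  have hk2 : k ≤ k ^ 2 := Nat.le_self_pow (by norm_num) k
  have hL3 : L ^ 3 ≤ L ^ 5 := Nat.pow_le_pow_right hL (by norm_num)
  have hL1 : L ≤ L ^ 5 := Nat.le_self_pow (by norm_num) L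
  have hkL : 1 ≤ k ^ 2 * L ^ 5 := Nat.mul_pos (by positivity) (by positivity)
  have e1 : (L + 1) * ((c + 3) * L * ((2 * c + 10) * k * L)) ≤
      2 * (c + 3) * (2 * c + 10) * (k ^ 2 * L ^ 5) := by
    calc (L + 1) * ((c + 3) * L * ((2 * c + 10) * k * L))
        ≤ (2 * L) * ((c + 3) * L * ((2 * c + 10) * k * L)) := by gcongr; omega
      _ = 2 * (c + 3) * (2 * c + 10) * (k * L ^ 3) := by ring
      _ ≤ _ := by gcongr
  have e2 : L ≤ k ^ 2 * L ^ 5 := hL1.trans (Nat.le_mul_of_pos_left _ (by positivity))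
  have e3 : (c + 3) * L * L * (4 * (512 * L * ((2 * c + 10) * k * L)) * (k + 1)) *
      ((2 * c + 10) * L + 1) ≤
      4096 * (c + 3) * (2 * c + 10) * (2 * c + 11) * (k ^ 2 * L ^ 5) := by
    calc (c + 3) * L * L * (4 * (512 * L * ((2 * c + 10) * k * L)) * (k + 1)) *
          ((2 * c + 10) * L + 1)
        ≤ (c + 3) * L * L * (4 * (512 * L * ((2 * c + 10) * k * L)) * (2 * k)) *
          ((2 * c + 10) * L + L) := by gcongr; omega
      _ = _ := by ring
  calc _ ≤ 2 * (c + 3) * (2 * c + 10) * (k ^ 2 * L ^ 5) + k ^ 2 * L ^ 5 + 2 * (k ^ 2 * L ^ 5) +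
        4096 * (c + 3) * (2 * c + 10) * (2 * c + 11) * (k ^ 2 * L ^ 5) := by
        gcongr; omega
    _ = _ := by ring

/-- With `N ≥ 2`, `2 ^ lgSize ≤ 2 * N ≤ N ^ 2`, and `2 / log 2 < 3`. -/
theorem lgSize_le_three_mul_log {n m k : ℕ} (hm : 1 ≤ m) :
    (lgSize (n, m, k) : ℝ) ≤ 3 * Real.log ((m : ℝ) + n + 1) := by
  set N : ℝ := (m : ℝ) + n + 1 with hN
  have hN2 : 2 ≤ N := by
    have : (1 : ℝ) ≤ m := by exact_mod_cast hm
    have : (0 : ℝ) ≤ n := Nat.cast_nonneg n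
    linarith
  have h1 : (2 : ℝ) ^ lgSize (n, m, k) ≤ N ^ 2 := by
    have h : (2 : ℝ) ^ lgSize (n, m, k) ≤ 2 * N := by
      have := two_pow_lgSize_le (n, m, k)
      have h' : ((2 ^ lgSize (n, m, k) : ℕ) : ℝ) ≤ ((2 * (n + m + 1) : ℕ) : ℝ) := by
        exact_mod_cast this
      push_cast at h'
      linarith
    nlinarith
  have h2 := Real.log_le_log (by positivity) h1
  rw [Real.log_pow, Real.log_pow] at h2
  have h3 := Real.log_two_gt_d9
  have h4 : (0 : ℝ) ≤ lgSize (n, m, k) := Nat.cast_nonneg _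
  push_cast at h2
  nlinarith

end Space

/-! ### Set systems over natural numbers -/

section Bridge

variable {m n : ℕ}

/-- The set system `S` over the natural numbers. -/
def natSets (S : Fin m → Finset (Fin n)) (i : ℕ) : Finset ℕ :=
  if h : i < m then (S ⟨i, h⟩).map Fin.valEmbedding else ∅

theorem natSets_val (S : Fin m → Finset (Fin n)) (i : Fin m) :
    natSets S i = (S i).map Fin.valEmbedding := by
  simp [natSets]

theorem natSets_of_le (S : Fin m → Finset (Fin n)) {i : ℕ} (hi : m ≤ i) : natSets S i = ∅ := by
  simp [natSets, hi.not_gt]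

theorem lt_of_mem_natSets (S : Fin m → Finset (Fin n)) (i : ℕ) : ∀ x ∈ natSets S i, x < n := by
  intro x hx
  unfold natSets at hx
  split_ifs at hx
  · obtain ⟨y, -, rfl⟩ := Finset.mem_map.1 hx
    exact y.2
  · simp at hx

theorem val_mem_natSets (S : Fin m → Finset (Fin n)) (i : Fin m) (x : Fin n) :
    (x : ℕ) ∈ natSets S i ↔ x ∈ S i := by
  rw [natSets_val]
  exact Finset.mem_map' Fin.valEmbedding

theorem filter_map_val (S : Fin m → Finset (Fin n)) (I : Finset (Fin m)) (x : Fin n) :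
    ((I.map Fin.valEmbedding).filter fun i => (x : ℕ) ∈ natSets S i)
      = (I.filter fun i => x ∈ S i).map Fin.valEmbedding := by
  rw [Finset.filter_map]
  congr 1
  ext i
  simp [val_mem_natSets]

theorem card_natUniquelyCovered (S : Fin m → Finset (Fin n)) (I : Finset (Fin m)) :
    (natUniquelyCovered n (natSets S) (I.map Fin.valEmbedding)).card
      = (uniquelyCovered S I).card := by
  rw [← Finset.card_map Fin.valEmbedding]
  congr 1
  ext x
  simp only [natUniquelyCovered, uniquelyCovered, Finset.mem_filter, Finset.mem_range,
    Finset.mem_map, Finset.mem_univ, true_and]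
  constructor
  · rintro ⟨hx, h⟩
    refine ⟨⟨x, hx⟩, ?_, rfl⟩
    rwa [filter_map_val S I ⟨x, hx⟩, Finset.card_map] at h
  · rintro ⟨y, h, rfl⟩
    refine ⟨y.2, ?_⟩
    rw [Fin.valEmbedding_apply, filter_map_val, Finset.card_map]
    exact h

theorem exists_eq_map_val {I : Finset ℕ} (hI : ∀ i ∈ I, i < m) :
    ∃ I' : Finset (Fin m), I'.map Fin.valEmbedding = I := by
  refine ⟨Finset.univ.filter fun i : Fin m => (i : ℕ) ∈ I, ?_⟩
  ext i
  simp only [Finset.mem_map, Finset.mem_filter, Finset.mem_univ, true_and, Fin.valEmbedding_apply]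
  constructor
  · rintro ⟨a, ha, rfl⟩
    exact ha
  · intro hi
    exact ⟨⟨i, hI i hi⟩, hi, rfl⟩

theorem exists_card_eq_opt (S : Fin m → Finset (Fin n)) (k : ℕ) :
    ∃ I : Finset (Fin m), I.card ≤ k ∧ (uniquelyCovered S I).card = opt S k := by
  obtain ⟨I, hI, h⟩ := Finset.exists_mem_eq_sup
    ((Finset.univ : Finset (Finset (Fin m))).filter fun I => I.card ≤ k) ⟨∅, by simp⟩
    (fun I => (uniquelyCovered S I).card)
  exact ⟨I, (Finset.mem_filter.1 hI).2, h.symm⟩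

theorem card_le_opt (S : Fin m → Finset (Fin n)) {k : ℕ} {I : Finset (Fin m)} (hI : I.card ≤ k) :
    (uniquelyCovered S I).card ≤ opt S k :=
  Finset.le_sup (f := fun I => (uniquelyCovered S I).card) (Finset.mem_filter.2
    ⟨Finset.mem_univ _, hI⟩)

theorem card_filter_natSets_le (S : Fin m → Finset (Fin n)) (x : ℕ) :
    ((Finset.range m).filter fun i => x ∈ natSets S i).card ≤ maxMultiplicity S := by
  by_cases hx : x < n
  · have hr : Finset.range m = (Finset.univ : Finset (Fin m)).map Fin.valEmbedding := by
      ext i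
      simp only [Finset.mem_range, Finset.mem_map, Finset.mem_univ, true_and,
        Fin.valEmbedding_apply]
      exact ⟨fun h => ⟨⟨i, h⟩, rfl⟩, fun ⟨a, ha⟩ => ha ▸ a.2⟩
    rw [hr, filter_map_val S _ ⟨x, hx⟩, Finset.card_map]
    exact Finset.le_sup (f := fun j : Fin n => (Finset.univ.filter fun i => j ∈ S i).card)
      (Finset.mem_univ _)
  · rw [Finset.card_eq_zero.2 (Finset.filter_false_of_mem fun i _ h =>
      hx (lt_of_mem_natSets S i x h))]
    exact Nat.zero_le _

theorem tokens_eq (L : Fin m → List (Fin n)) :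
    tokens L = ((List.ofFn L).map (List.map Fin.val)).flatMap setTokens := by
  rw [tokens, List.flatMap_map]
  congr 1
  funext l
  simp only [setTokens, List.bind_eq_flatMap, List.pure_def,
    ← List.map_eq_flatMap]

variable {c k ω : ℕ}

theorem nodup_of_mem_lists {S : Fin m → Finset (Fin n)} {L : Fin m → List (Fin n)}
    (hL : Lists L S) : ∀ l ∈ (List.ofFn L).map (List.map Fin.val), l.Nodup := by
  intro l hl
  obtain ⟨l', hl', rfl⟩ := List.mem_map.1 hl
  obtain ⟨i, rfl⟩ := List.mem_ofFn.1 hl'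
  exact (hL i).1.map Fin.val_injective

theorem toFinset_getElem_lists {S : Fin m → Finset (Fin n)} {L : Fin m → List (Fin n)}
    (hL : Lists L S) (t : ℕ) (ht : t < ((List.ofFn L).map (List.map Fin.val)).length) :
    ((List.ofFn L).map (List.map Fin.val))[t].toFinset = natSets S (0 + t) := by
  have ht' : t < m := by simpa using ht
  rw [zero_add, natSets_val S ⟨t, ht'⟩, ← (hL ⟨t, ht'⟩).2]
  ext x
  simp

theorem exists_isRunState_of_prefix (hk : 1 ≤ k) {S : Fin m → Finset (Fin n)}
    {L : Fin m → List (Fin n)} (hL : Lists L S) {v : List (Option ℕ)} (hv : v <+: tokens L) :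
    ∃ cur cl recs, cur ≤ m ∧ v.foldl (readToken c (n, m, k)) [ω, 0] = ω :: cur :: recs ∧
      IsRunState c (n, m, k) ω (natSets S) cur cl recs := by
  rw [tokens_eq] at hv
  obtain ⟨cur, cl, recs, h1, h2, h3⟩ := foldl_prefix_stream (p := (n, m, k)) hk
    (lt_of_mem_natSets S) _ (isRunState_nil (c := c) (ω := ω) hk) (nodup_of_mem_lists hL)
    (toFinset_getElem_lists hL) hv
  exact ⟨cur, cl, recs, by simpa using h1, h2, h3⟩

theorem exists_isRunState_of_stream (hk : 1 ≤ k) {S : Fin m → Finset (Fin n)}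
    {L : Fin m → List (Fin n)} (hL : Lists L S) :
    ∃ recs, (tokens L).foldl (readToken c (n, m, k)) [ω, 0] = ω :: m :: recs ∧
      IsRunState c (n, m, k) ω (natSets S) m ∅ recs := by
  obtain ⟨recs, h1, h2⟩ := foldl_stream (p := (n, m, k)) hk
    (lt_of_mem_natSets S) _ (isRunState_nil (c := c) (ω := ω) hk) (nodup_of_mem_lists hL)
    (toFinset_getElem_lists hL)
  rw [← tokens_eq] at h1
  have hlen : 0 + ((List.ofFn L).map (List.map Fin.val)).length = m := by simp
  rw [hlen] at h1 h2
  exact ⟨recs, h1, h2⟩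

/-! ### The main result -/

theorem streamAlg_usesSpace (hk : 1 ≤ k) (hkm : k ≤ m) {S : Fin m → Finset (Fin n)}
    {L : Fin m → List (Fin n)} (hL : Lists L S) :
    (streamAlg c).UsesSpace (n, m, k) (tokens L)
      ((spaceConst c * 3 ^ 5 : ℕ) * (k : ℝ) ^ 2 * Real.log ((m : ℝ) + (n : ℝ) + 1) ^ 5) := by
  have hspace := space_le (c := c) (p := (n, m, k)) hk
  have hlog := lgSize_le_three_mul_log (n := n) (k := k) (hk.trans hkm)
  have hbound : ∀ s : ℕ, s ≤ spaceConst c * k ^ 2 * lgSize (n, m, k) ^ 5 →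
      (s : ℝ) ≤ (spaceConst c * 3 ^ 5 : ℕ) * (k : ℝ) ^ 2 *
        Real.log ((m : ℝ) + (n : ℝ) + 1) ^ 5 := by
    intro s hs
    calc (s : ℝ) ≤ (spaceConst c : ℝ) * (k : ℝ) ^ 2 * (lgSize (n, m, k) : ℝ) ^ 5 := by
          exact_mod_cast hs
      _ ≤ (spaceConst c : ℝ) * (k : ℝ) ^ 2 *
          (3 * Real.log ((m : ℝ) + (n : ℝ) + 1)) ^ 5 := by gcongr
      _ = _ := by push_cast; ring
  refine ⟨hbound _ (le_trans (by omega) hspace), fun v hv M hM => hbound _ (le_trans ?_ hspace)⟩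
  rw [streamAlg_law] at hM
  obtain ⟨ω, hω, rfl⟩ := (PMF.mem_support_map_iff _ _ _).1 hM
  obtain ⟨cur, cl, recs, h1, h2, h3⟩ := exists_isRunState_of_prefix (c := c) (ω := ω) hk hL hv
  rw [h2]
  exact h3.memSize_le h1 (lt_two_pow_of_mem_support_coinLaw hω)

/-- Since `1 / log 2 < 2`, changing the base doubles 512 to 1024. The case `x = 0`, needed when all
sets are empty, is included because both logarithms are 0 there. -/
theorem natLog_two_le (x : ℕ) : 1 + (Nat.log 2 x : ℝ) ≤ 2 * (1 + Real.log x) := by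
  have h1 := Real.natLog_le_logb x 2
  have h2 := Real.log_two_gt_d9
  have h3 := Real.log_natCast_nonneg x
  have h4 : Real.logb (2 : ℕ) x ≤ 2 * Real.log x := by
    rw [Real.logb, div_le_iff₀ (by push_cast; linarith)]
    push_cast
    nlinarith
  linarith

theorem isApproxSolution_of_le {S : Fin m → Finset (Fin n)} {r : ℕ} {o : List ℕ}
    (hom : ∀ i ∈ o, i < m) (hok : o.toFinset.card ≤ k)
    (ho : opt S k ≤ 512 * (1 + Nat.log 2 (min k r)) *
      (natUniquelyCovered n (natSets S) o.toFinset).card) :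
    IsApproxSolution S k (1024 * (1 + Real.log (min (k : ℝ) (r : ℝ)))) o := by
  obtain ⟨I, hI⟩ := exists_eq_map_val (m := m) (I := o.toFinset)
    fun i hi => hom i (List.mem_toFinset.1 hi)
  rw [← hI, card_natUniquelyCovered] at ho
  refine ⟨I, ?_, ?_, ?_⟩
  · rw [← hI, Finset.map_eq_image]
    rfl
  · rwa [← hI, Finset.card_map] at hok
  · have h : (opt S k : ℝ) ≤ 512 * (1 + (Nat.log 2 (min k r) : ℝ)) *
        ((uniquelyCovered S I).card : ℝ) := by exact_mod_cast ho
    refine h.trans ?_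
    have h1 := natLog_two_le (min k r)
    rw [Nat.cast_min] at h1
    refine mul_le_mul_of_nonneg_right ?_ (Nat.cast_nonneg _)
    linarith

theorem streamAlg_succeeds (hk : 1 ≤ k) (hkm : k ≤ m) {S : Fin m → Finset (Fin n)}
    {L : Fin m → List (Fin n)} (hL : Lists L S) :
    ((streamAlg c).outLaw (n, m, k) (tokens L)).toOuterMeasure
      {o | ¬ IsApproxSolution S k
        (1024 * (1 + Real.log (min (k : ℝ) (maxMultiplicity S : ℝ)))) o}
      ≤ ((m : ℝ≥0∞) ^ c)⁻¹ := by
  classical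
  obtain ⟨I₀, hI₀k, hI₀⟩ := exists_card_eq_opt S k
  rw [← card_natUniquelyCovered] at hI₀
  set U₀ := natUniquelyCovered n (natSets S) (I₀.map Fin.valEmbedding) with hU₀
  set i₀ := Nat.log 2 (opt S k) with hi₀
  have hU₀n : ∀ x ∈ U₀, x < n := fun x hx => Finset.mem_range.1 (Finset.mem_filter.1 hx).1
  rw [StreamAlg.outLaw, streamAlg_law, PMF.map_comp, PMF.toOuterMeasure_map_apply, ← Nat.cast_pow]
  have hm : m ^ c ≠ 0 := pow_ne_zero _ (by omega)
  -- If OPT is 0 no level matches it, but any answer with at most `k` sets will do, so there are no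
  -- bad seeds.
  rcases Nat.eq_zero_or_pos (opt S k) with h0 | hpos
  · refine toOuterMeasure_coinLaw_le (G := ∅) (fun ω _ hω => ?_) (by simp) hm
    obtain ⟨recs, h1, h2⟩ := exists_isRunState_of_stream (c := c) (ω := ω) hk hL
    refine absurd (isApproxSolution_of_le ?_ (h2.card_answer_le (lt_of_mem_natSets S)) ?_)
      (by simpa [h1, streamAlg] using hω)
    · intro i hi
      simpa using (List.mem_filter.1 hi).1
    · exact h0.le.trans (Nat.zero_le _)
  · have hlow : 2 ^ i₀ ≤ U₀.card := by rw [hI₀]; exact Nat.pow_log_le_self 2 hpos.ne'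
    have hupp : U₀.card < 2 ^ (i₀ + 1) := by
      rw [hI₀]; exact Nat.lt_pow_succ_log_self (by norm_num) _
    -- OPT is at most `n`, so the right guess is among the levels that are tried.
    have hi₀L : i₀ < lgSize (n, m, k) := by
      have h1 : U₀.card ≤ n := (Finset.card_filter_le _ _).trans (by simp)
      have h2 := lt_two_pow_lgSize (n, m, k)
      simp only at h2
      exact (Nat.pow_lt_pow_iff_right (by norm_num : 1 < 2)).1 (by omega)
    refine toOuterMeasure_coinLaw_le (fun ω hω hbad => ?_)
      (card_not_isGoodSeed_le c (p := (n, m, k)) hk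
        (fun U hU => lt_of_mem_coverageFamily hU) (card_coverageFamily_le (𝒮 := natSets S)) hi₀L
        hU₀n hlow) hm
    refine Finset.mem_filter.2 ⟨Finset.mem_range.2 hω, fun hgood => ?_⟩
    obtain ⟨recs, h1, h2⟩ := exists_isRunState_of_stream (c := c) (ω := ω) hk hL
    refine absurd (isApproxSolution_of_le ?_ (h2.card_answer_le (lt_of_mem_natSets S)) ?_)
      (by simpa [h1, streamAlg] using hbad)
    · intro i hi
      simpa using (List.mem_filter.1 hi).1
    · rw [← hI₀]
      refine h2.le_card_answer hk hkm (lt_of_mem_natSets S) (fun i hi => natSets_of_le S hi)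
        (card_filter_natSets_le S) (by rwa [Finset.card_map]) ?_ ?_ hi₀L hlow hupp hgood
      · intro i hi
        obtain ⟨a, -, rfl⟩ := Finset.mem_map.1 hi
        exact a.2
      · intro I hI hIk
        obtain ⟨I', rfl⟩ := exists_eq_map_val (m := m) (I := I)
          fun i hi => Finset.mem_range.1 (hI hi)
        rw [Finset.card_map] at hIk
        change (natUniquelyCovered n (natSets S) _).card ≤ U₀.card
        rw [hI₀, card_natUniquelyCovered]
        exact card_le_opt S hIk

end Bridge

end UniqueCoverage

theorem mainTheorem9 :
    ∃ A : ℝ, 0 < A ∧ ∀ c : ℕ, ∃ (alg : UniqueCoverage.StreamAlg) (B : ℝ) (b : ℕ),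
      ∀ n m k : ℕ, 1 ≤ k → k ≤ m →
      ∀ (S : Fin m → Finset (Fin n)) (L : Fin m → List (Fin n)), UniqueCoverage.Lists L S →
        alg.UsesSpace (n, m, k) (UniqueCoverage.tokens L)
          (B * (k : ℝ) ^ 2 * Real.log ((m : ℝ) + (n : ℝ) + 1) ^ b) ∧
        (alg.outLaw (n, m, k) (UniqueCoverage.tokens L)).toOuterMeasure
          {o | ¬ UniqueCoverage.IsApproxSolution S k
            (A * (1 + Real.log (min (k : ℝ) (UniqueCoverage.maxMultiplicity S : ℝ)))) o}
          ≤ ((m : ℝ≥0∞) ^ c)⁻¹ :=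
  ⟨1024, by norm_num, fun c => ⟨UniqueCoverage.streamAlg c,
    (UniqueCoverage.spaceConst c * 3 ^ 5 : ℕ), 5, fun _ _ _ hk hkm _ _ hL =>
      ⟨UniqueCoverage.streamAlg_usesSpace hk hkm hL,
        UniqueCoverage.streamAlg_succeeds hk hkm hL⟩⟩⟩
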